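/- **Setting.** For $n\ge 0$ put $U=n+1$ and identify polynomials of degree at most $n$ with their coefficient vectors $\mathbf s\in\mathbb R^{U}$ in the monomial basis $\mathbf q(z)=(1,z,\dots,z^{n})$. If $n=2d$ let $w_1=1$, $w_2=1-z^2$, $L_1=d+1$, $L_2=d$; if $n=2d+1$ let $w_1=1-z$, $w_2=1+z$, $L_1=L_2=d+1$. Let $\Sigma\subset\mathbb R^U$ be the cone of polynomials $w_1\sigma_1+w_2\sigma_2$, where $\sigma_i$ is a sum of squares of polynomials of degree less than $L_i$ (classically, these are the polynomials of degree at most $n$ that are nonnegative on $[-1,1]$), and let $\Sigma^*=\{\mathbf y:\mathbf s^{\mathrm T}\mathbf y\ge0\ \ \forall\,\mathbf s\in\Sigma\}$. Let $\mathbf 1$ be the coefficient vector of the constant polynomial $1$ and $$k_1^{\mathbf 1}=\min\{\mathbf 1^{\mathrm T}\mathbf v : \mathbf v\in\Sigma^*,\ \|\mathbf v\|_\infty=1\}.$$ For $i=1,2$ let $\mathbf p_i$ be any basis of the space of polynomials of degree less than $L_i$, let $\Lambda_i$ be the linear map from $\mathbb R^U$ to the symmetric $L_i\times L_i$ matrices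 with $\Lambda_i(\mathbf q(z))=w_i(z)\mathbf p_i(z)\mathbf p_i(z)^{\mathrm T}$, let $\Lambda=\Lambda_1\oplus\Lambda_2$, and let $H(\mathbf x)$ be the Hessian of $f(\mathbf x)=-\ln\det\Lambda(\mathbf x)$ on the interior $(\Sigma^*)^\circ$. A vector $\mathbf x\in(\Sigma^*)^\circ$ is a dual certificate of $\mathbf s\in\Sigma$ if $H(\mathbf x)^{-1}\mathbf s\in\Sigma^*$. Call a matrix $\mathbf M$ admissible if $\mathbf M=\sum_{i=1}^{s}\alpha_i\,\mathbf q(z_i)\mathbf q(z_i)^{\mathrm T}$ with $\alpha_i>0$ and finitely many distinct points $z_i\in[-1,1]$ that are unisolvent for the polynomials of degree at most $n$; put $\operatorname{cond}(\mathbf M)=\lambda_{\max}(\mathbf M)/\lambda_{\min}(\mathbf M)$. The bit size of an integer $a$ is $1+\lceil\log_2(|a|+1)\rceil$. **Theorem.** (1) For every $n\ge0$ the minimum defining $k_1^{\mathbf 1}$ is attained, and $k_1^{\mathbf 1}\ge1$. (2) For every $n\ge 0$ the $U\times U$ Hilbert matrix $\bigl(1/(i+j+1)\bigr)_{0\le i,j<U}$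 is admissible, and its condition number is at most $K\,(1+\sqrt2)^{4U}/\sqrt U$, with an absolute constant $K$. (3) There is an absolute constant $K$ such that for all $d\ge0$ and $n\in\{2d,2d+1\}$, all bases $\mathbf p_1,\mathbf p_2$, all $\mathbf t$ in the interior of $\Sigma$ and all $\varepsilon>0$ with $\mathbf t-\varepsilon\mathbf 1$ on the boundary of $\Sigma$, there is a dual certificate $\overline{\mathbf y}\in(\Sigma^*)^\circ\cap\mathbb Z^{U}$ of $\mathbf t$ with $$\|\overline{\mathbf y}\|_\infty\le K\,(d+1)^{5/4}(1+\sqrt2)^{4d+4}\,\frac{\|\mathbf t\|_2}{\varepsilon},\qquad \log\|\overline{\mathbf y}\|_\infty\le K\bigl(d+1+\log\|\mathbf t\|_2+\log(1/\varepsilon)\bigr),$$ and every component of $\overline{\mathbf y}$ has bit size at most $K\bigl(d+1+\log\|\mathbf t\|_2+\log(1/\varepsilon)\bigr)$. -/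

import Mathlib

open Polynomial

noncomputable section

namespace WSOS

/-- The polynomial `s₀ + s₁ X + ⋯ + s_{U-1} X^{U-1}` with coefficient vector `s` in the monomial
basis `q = (1, X, …, X^{U-1})`. -/
def toPoly {U : ℕ} (s : EuclideanSpace ℝ (Fin U)) : ℝ[X] :=
  ∑ u : Fin U, C (s u) * X ^ (u : ℕ)

/-- The coefficient vector of a polynomial of degree `< U` in the monomial basis. -/
def coeffVec (U : ℕ) (r : ℝ[X]) : EuclideanSpace ℝ (Fin U) :=
  WithLp.toLp 2 fun u => r.coeff u

/-- The sup norm `‖v‖_∞` of a vector (the norm of `EuclideanSpace` itself is `‖v‖₂`). -/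
def supNorm {U : ℕ} (v : EuclideanSpace ℝ (Fin U)) : ℝ :=
  ‖WithLp.ofLp v‖

/-- `σ` is a sum of squares of polynomials of degree `< L`. -/
def IsSOS (L : ℕ) (σ : ℝ[X]) : Prop :=
  ∃ (k : ℕ) (r : Fin k → ℝ[X]), (∀ j, r j ∈ degreeLT ℝ L) ∧ σ = ∑ j, r j ^ 2

variable {m : ℕ} (w : Fin m → ℝ[X]) (L : Fin m → ℕ) (U : ℕ)

/-- The weighted sums-of-squares cone `Σ`: the coefficient vectors of the polynomials
`∑ i, w i * σ i`, where `σ i` is a sum of squares of polynomials of degree `< L i`. -/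
def cone : Set (EuclideanSpace ℝ (Fin U)) :=
  {s | ∃ σ : Fin m → ℝ[X], (∀ i, IsSOS (L i) (σ i)) ∧ toPoly s = ∑ i, w i * σ i}

/-- The dual cone `Σ*`, with respect to the standard inner product. -/
def dualCone : Set (EuclideanSpace ℝ (Fin U)) :=
  (ProperCone.innerDual (cone w L U) : Set (EuclideanSpace ℝ (Fin U)))

/-- The set `S_w` on which all the weights are nonnegative. -/
def domain : Set ℝ :=
  {z | ∀ i, 0 ≤ (w i).eval z}

variable {L} (p : ∀ i, Module.Basis (Fin (L i)) ℝ (degreeLT ℝ (L i)))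

/-- The linear map `Λ_i` characterised by `Λ_i(q(z)) = w_i(z) p_i(z) p_i(z)ᵀ`: the `(j, k)` entry
is obtained from the expansion of `w_i p_{i,j} p_{i,k}` in the monomial basis by replacing the
monomial `X^u` with `x u`. -/
def lambdaBlock (i : Fin m) (x : EuclideanSpace ℝ (Fin U)) :
    Matrix (Fin (L i)) (Fin (L i)) ℝ :=
  Matrix.of fun j k => ∑ u : Fin U, (w i * (p i j : ℝ[X]) * (p i k : ℝ[X])).coeff u * x u

/-- The block diagonal matrix `Λ(x) = Λ_1(x) ⊕ ⋯ ⊕ Λ_m(x)`. -/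
def lambda (x : EuclideanSpace ℝ (Fin U)) :
    Matrix (Σ i : Fin m, Fin (L i)) (Σ i : Fin m, Fin (L i)) ℝ :=
  Matrix.blockDiagonal' fun i => lambdaBlock w U p i x

/-- The barrier function `f(x) = -ln det Λ(x)`; only its values on the interior of the dual cone,
where `Λ(x)` is positive definite, are meaningful. -/
def barrier (x : EuclideanSpace ℝ (Fin U)) : ℝ :=
  -Real.log (lambda w U p x).det

/-- The Hessian `H(x)` of the barrier function, as a linear operator: the derivative of the
gradient. -/
def hessian (x : EuclideanSpace ℝ (Fin U)) :
    EuclideanSpace ℝ (Fin U) →L[ℝ] EuclideanSpace ℝ (Fin U) :=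
  fderiv ℝ (fun y => gradient (barrier w U p) y) x

/-- `x` is a dual certificate of `s ∈ Σ`: `x` lies in the interior of `Σ*` and
`H(x)⁻¹ s ∈ Σ*`. Invertibility of `H(x)` is required explicitly, so that the inverse is a genuine
one. -/
def IsDualCertificate (x s : EuclideanSpace ℝ (Fin U)) : Prop :=
  s ∈ cone w L U ∧ x ∈ interior (dualCone w L U) ∧
    (hessian w U p x).IsInvertible ∧ (hessian w U p x).inverse s ∈ dualCone w L U

variable (L)

/-- The values `eᵀ v` with `v ∈ Σ*` and `‖v‖_∞ = 1`. -/
def k1Values (e : EuclideanSpace ℝ (Fin U)) : Set ℝ :=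
  (fun v => inner ℝ e v) '' {v | v ∈ dualCone w L U ∧ supNorm v = 1}

/-- The constant `k₁ᵉ = min {eᵀ v | v ∈ Σ*, ‖v‖_∞ = 1}`. -/
def k1 (e : EuclideanSpace ℝ (Fin U)) : ℝ :=
  sInf (k1Values w L U e)

/-- The points `z i` are unisolvent for the polynomials of degree `< U`: such a polynomial is
determined by its values at these points. -/
def Unisolvent {s : ℕ} (z : Fin s → ℝ) : Prop :=
  ∀ r₁ ∈ degreeLT ℝ U, ∀ r₂ ∈ degreeLT ℝ U, (∀ i, r₁.eval (z i) = r₂.eval (z i)) → r₁ = r₂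

variable {U}

/-- `M` is of the form `∑ i, α i • q(z i) q(z i)ᵀ` with finitely many distinct points `z i` in
`S_w` that are unisolvent for the polynomials of degree `< U`, and with weights `α i > 0`;
here `q(z) = (1, z, …, z^{U-1})`. -/
def IsAdmissible (M : Matrix (Fin U) (Fin U) ℝ) : Prop :=
  ∃ (s : ℕ) (z : Fin s → ℝ) (α : Fin s → ℝ),
    Function.Injective z ∧ (∀ i, z i ∈ domain w) ∧ Unisolvent U z ∧ (∀ i, 0 < α i) ∧
      M = ∑ i, α i • Matrix.vecMulVec (fun u : Fin U => z i ^ (u : ℕ)) (fun u : Fin U => z i ^ (u : ℕ))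

/-- The condition number `λ_max(M) / λ_min(M)` of a positive definite matrix. -/
def cond (M : Matrix (Fin U) (Fin U) ℝ) : ℝ :=
  sSup (spectrum ℝ M) / sInf (spectrum ℝ M)

/-- The `U × U` Hilbert matrix, with entries `1 / (i + j + 1)` for `i, j = 0, …, U - 1`. -/
def hilbert (U : ℕ) : Matrix (Fin U) (Fin U) ℝ :=
  Matrix.of fun i j => 1 / ((i : ℝ) + (j : ℝ) + 1)

/-- The weights used for polynomials of degree at most `n` that are nonnegative on `[-1, 1]`:
`1, 1 - X²` if `n` is even and `1 - X, 1 + X` if `n` is odd. -/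
def intervalWeights (n : ℕ) : Fin 2 → ℝ[X] :=
  if Even n then ![1, 1 - X ^ 2] else ![1 - X, 1 + X]

/-- The dimensions of the spaces of polynomials squared in the two terms: `d + 1, d` (degrees at
most `d` and `d - 1`) if `n = 2 * d`, and `d + 1, d + 1` if `n = 2 * d + 1`. -/
def intervalDims (n : ℕ) : Fin 2 → ℕ :=
  ![n / 2 + 1, (n + 1) / 2]

/-- The bit size `1 + ⌈log₂ (|a| + 1)⌉` of an integer. -/
def bitSize (a : ℤ) : ℤ :=
  1 + ⌈Real.logb 2 (|(a : ℝ)| + 1)⌉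

/-- An integer vector, regarded as a real one. -/
def ofInt {U : ℕ} (y : Fin U → ℤ) : EuclideanSpace ℝ (Fin U) :=
  WithLp.toLp 2 fun u => (y u : ℝ)

end WSOS

end

/-! For `P = Λ(x)` positive definite, the Hessian of the barrier is the local inner product `tr (P⁻¹
Λ(h) P⁻¹ Λ(k))`. Maximising `det Λ` on a slice of the dual cone produces `x` with `t = -∇f(x)`
(`exists_trace_inv_mul_eq_inner`). The whole open local unit ball around any positive multiple `M x`
consists of dual certificates of `t` (`isDualCertificate_of_localForm_lt`). Passing from `x` to `M
x` divides local norms by `M`, so for large `M` rounding `M x` to integers stays inside the ball.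

How large `M` must be depends on how the local norm compares with the Euclidean one. The Hilbert
matrix `H` is the moment matrix of Lebesgue measure on `[0,1]`, and by Carathéodory also that of a
finite positive quadrature rule with nodes `z_i`. Expanding `h` in the vectors `q(z_i)`, whose local
norms are at most `t(z_i)`, and applying Cauchy–Schwarz bounds the squared local norm of `h` by `(hᵀ
H⁻¹ h)(tᵀ H t)` (`localForm_le_of_trace_eq`). So both extreme eigenvalues of `H` enter, as in the
condition number.

The Schur test gives `H ≤ 8` (`hilbert_le_dotProduct`). The shifted Legendre polynomials factor `H⁻¹
= Tᵀ T`, and the squared Frobenius norm of `T` is a weighted sum of Apéry numbers. Their three-term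
recurrence yields the growth `(1+√2)^(4k) / k^(3/2)` (`apery_ratio`), hence the bound on `H⁻¹`
(`dotProduct_le_hilbert`).

Finally, on the dual cone the zeroth moment dominates all the others (`abs_apply_le_apply_zero`).
This gives `k₁ ≥ 1`, and it bounds `x`, because `ε x₀ ≤ ⟪t, x⟫ = n + 1`. -/

open Polynomial

noncomputable section

namespace WSOS

/-! ### Local norms of the log-det barrier on symmetric matrices. -/

section MatrixForm

open Matrix

variable {N : Type*} [Fintype N]

lemma trace_mul_self_of_isSymm {X : Matrix N N ℝ} (hX : X.IsSymm) :
    (X * X).trace = ∑ ij : N × N, X ij.1 ij.2 ^ 2 := by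
  simp only [trace, diag_apply, mul_apply, Fintype.sum_prod_type]
  refine Finset.sum_congr rfl fun i _ => Finset.sum_congr rfl fun j _ => ?_
  rw [hX.apply i j, sq]

lemma trace_mul_of_isSymm {X Y : Matrix N N ℝ} (hX : X.IsSymm) :
    (Y * X).trace = ∑ ij : N × N, Y ij.1 ij.2 * X ij.1 ij.2 := by
  simp only [trace, diag_apply, mul_apply, Fintype.sum_prod_type]
  refine Finset.sum_congr rfl fun i _ => Finset.sum_congr rfl fun j _ => ?_
  rw [hX.apply i j]

lemma sq_trace_mul_le {X Y : Matrix N N ℝ} (hX : X.IsSymm) (hY : Y.IsSymm) :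
    (X * Y).trace ^ 2 ≤ (X * X).trace * (Y * Y).trace := by
  rw [trace_mul_self_of_isSymm hX, trace_mul_self_of_isSymm hY, trace_mul_of_isSymm hY]
  exact Finset.sum_mul_sq_le_sq_mul_sq _ _ _

lemma trace_mul_self_nonneg {X : Matrix N N ℝ} (hX : X.IsSymm) : 0 ≤ (X * X).trace := by
  rw [trace_mul_self_of_isSymm hX]
  positivity

lemma sq_dotProduct_mulVec_le {X : Matrix N N ℝ} (hX : X.IsSymm) (v : N → ℝ) :
    (v ⬝ᵥ X *ᵥ v) ^ 2 ≤ (X * X).trace * (v ⬝ᵥ v) ^ 2 := by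
  have h : v ⬝ᵥ X *ᵥ v = ∑ ij : N × N, X ij.1 ij.2 * (v ij.1 * v ij.2) := by
    simp only [dotProduct, mulVec, Fintype.sum_prod_type, Finset.mul_sum]
    exact Finset.sum_congr rfl fun i _ => Finset.sum_congr rfl fun j _ => by ring
  have h2 : (v ⬝ᵥ v) ^ 2 = ∑ ij : N × N, (v ij.1 * v ij.2) ^ 2 := by
    simp only [dotProduct, Fintype.sum_prod_type, sq, Finset.sum_mul_sum]
    exact Finset.sum_congr rfl fun i _ => Finset.sum_congr rfl fun j _ => by ring
  rw [h, h2, trace_mul_self_of_isSymm hX]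
  exact Finset.sum_mul_sq_le_sq_mul_sq _ _ _

lemma abs_dotProduct_mulVec_le {X : Matrix N N ℝ} (hX : X.IsSymm) (v : N → ℝ) :
    |v ⬝ᵥ X *ᵥ v| ≤ √(X * X).trace * (v ⬝ᵥ v) := by
  have hv : 0 ≤ v ⬝ᵥ v := by simpa using dotProduct_star_self_nonneg v
  rw [← Real.sqrt_sq hv, ← Real.sqrt_mul (trace_mul_self_nonneg hX)]
  exact Real.abs_le_sqrt (sq_dotProduct_mulVec_le hX v)

lemma isSymm_transpose_mul_mul {X : Matrix N N ℝ} (hX : X.IsSymm) (D : Matrix N N ℝ) :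
    (Dᵀ * X * D).IsSymm := by
  simp [IsSymm, transpose_mul, hX.eq, mul_assoc]

variable [DecidableEq N]

/-- The bilinear form `tr (P⁻¹ X P⁻¹ Y)`, the local inner product of the log-det barrier at `P`. -/
def localForm (P X Y : Matrix N N ℝ) : ℝ :=
  (P⁻¹ * X * P⁻¹ * Y).trace

/-- The Frobenius norm dominates the quadratic form: `|vᵀ X v| ≤ ‖X‖_F |v|²`. -/
lemma posSemidef_one_add {X : Matrix N N ℝ} (hX : X.IsSymm) (h : (X * X).trace ≤ 1) :
    (1 + X).PosSemidef := by
  refine .of_dotProduct_mulVec_nonneg ?_ fun v => ?_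
  · exact (isHermitian_one.add (by simpa [IsHermitian, conjTranspose_eq_transpose_of_trivial] using hX.eq))
  · have hv : 0 ≤ v ⬝ᵥ v := by simpa using dotProduct_star_self_nonneg v
    have h1 := abs_dotProduct_mulVec_le hX v
    have h2 : √(X * X).trace ≤ 1 := Real.sqrt_le_one.mpr h
    have h3 := (abs_le.mp h1).1
    simp only [star_trivial, add_mulVec, one_mulVec, dotProduct_add]
    nlinarith

lemma posDef_one_add {X : Matrix N N ℝ} (hX : X.IsSymm) (h : (X * X).trace < 1) :
    (1 + X).PosDef := by
  refine .of_dotProduct_mulVec_pos ?_ fun v hv0 => ?_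
  · exact (isHermitian_one.add (by simpa [IsHermitian, conjTranspose_eq_transpose_of_trivial] using hX.eq))
  · have hv : 0 < v ⬝ᵥ v := by simpa using dotProduct_star_self_pos_iff.mpr hv0
    have h1 := abs_dotProduct_mulVec_le hX v
    have h2 : √(X * X).trace < 1 := (Real.sqrt_lt' one_pos).mpr (by simpa using h)
    have h3 := (abs_le.mp h1).1
    simp only [star_trivial, add_mulVec, one_mulVec, dotProduct_add]
    nlinarith

/-- As a Gram matrix, `X` has entries `⟨b_i, b_j⟩`, bounded by Cauchy–Schwarz by the product of the
lengths, whose squares are the diagonal entries. -/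
lemma trace_mul_self_le_sq_trace {X : Matrix N N ℝ} (hX : X.PosSemidef) :
    (X * X).trace ≤ X.trace ^ 2 := by
  obtain ⟨B, rfl⟩ : ∃ B, X = Bᵀ * B := by
    open scoped MatrixOrder in
    obtain ⟨B, hB⟩ := CStarAlgebra.nonneg_iff_eq_star_mul_self.mp hX.nonneg
    exact ⟨B, by simpa [star_eq_conjTranspose, conjTranspose_eq_transpose_of_trivial] using hB⟩
  rw [trace_mul_self_of_isSymm (by simp [IsSymm]), sq, trace, Finset.sum_mul_sum,
    Fintype.sum_prod_type]
  refine Finset.sum_le_sum fun i _ => Finset.sum_le_sum fun j _ => ?_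
  simp only [diag_apply, mul_apply, transpose_apply, ← sq]
  exact Finset.sum_mul_sq_le_sq_mul_sq _ _ _

/-- Congruence by `D` carries `P` to the identity and the local form at `P` to the Frobenius form,
which reduces the lemmas below to the case `P = 1`. -/
lemma exists_transpose_mul_mul_eq_one {P : Matrix N N ℝ} (hP : P.PosDef) :
    ∃ D : Matrix N N ℝ, IsUnit D ∧ Dᵀ * P * D = 1 ∧ P⁻¹ = D * Dᵀ := by
  obtain ⟨B, hB⟩ : ∃ B, P = Bᵀ * B := by
    open scoped MatrixOrder in
    obtain ⟨B, hB⟩ := CStarAlgebra.nonneg_iff_eq_star_mul_self.mp hP.posSemidef.nonneg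
    exact ⟨B, by simpa [star_eq_conjTranspose, conjTranspose_eq_transpose_of_trivial] using hB⟩
  have hdet : IsUnit B.det := by
    have h := hP.det_pos.ne'
    rw [hB, det_mul, det_transpose] at h
    exact isUnit_iff_ne_zero.mpr (left_ne_zero_of_mul h)
  refine ⟨B⁻¹, ?_, ?_, ?_⟩
  · rw [isUnit_iff_isUnit_det]; exact isUnit_nonsing_inv_det _ hdet
  · have h1 : B * B⁻¹ = 1 := mul_nonsing_inv _ hdet
    have h2 : B⁻¹ᵀ * Bᵀ = 1 := by rw [← transpose_mul, h1, transpose_one]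
    rw [hB, ← mul_assoc, h2, one_mul, h1]
  · rw [hB, Matrix.mul_inv_rev, transpose_nonsing_inv]

lemma localForm_eq_trace {P D : Matrix N N ℝ} (hD : P⁻¹ = D * Dᵀ) (X Y : Matrix N N ℝ) :
    localForm P X Y = ((Dᵀ * X * D) * (Dᵀ * Y * D)).trace := by
  rw [localForm, hD]
  simp only [mul_assoc]
  rw [trace_mul_comm D]
  simp only [mul_assoc]

lemma localForm_self_nonneg {P X : Matrix N N ℝ} (hP : P.PosDef) (hX : X.IsSymm) :
    0 ≤ localForm P X X := by
  obtain ⟨D, -, -, hD⟩ := exists_transpose_mul_mul_eq_one hP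
  rw [localForm_eq_trace hD]
  exact trace_mul_self_nonneg (isSymm_transpose_mul_mul hX D)

lemma sq_localForm_le {P X Y : Matrix N N ℝ} (hP : P.PosDef) (hX : X.IsSymm) (hY : Y.IsSymm) :
    localForm P X Y ^ 2 ≤ localForm P X X * localForm P Y Y := by
  obtain ⟨D, -, -, hD⟩ := exists_transpose_mul_mul_eq_one hP
  simp only [localForm_eq_trace hD]
  exact sq_trace_mul_le (isSymm_transpose_mul_mul hX D) (isSymm_transpose_mul_mul hY D)

lemma eq_zero_of_localForm_self_eq_zero {P X : Matrix N N ℝ} (hP : P.PosDef) (hX : X.IsSymm)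
    (h : localForm P X X = 0) : X = 0 := by
  obtain ⟨D, hu, -, hD⟩ := exists_transpose_mul_mul_eq_one hP
  rw [localForm_eq_trace hD, trace_mul_self_of_isSymm (isSymm_transpose_mul_mul hX D),
    Finset.sum_eq_zero_iff_of_nonneg fun _ _ => sq_nonneg _] at h
  have h0 : Dᵀ * X * D = 0 := by
    ext i j
    simpa using h (i, j) (Finset.mem_univ _)
  have hu' : IsUnit Dᵀ := by
    rw [isUnit_iff_isUnit_det] at hu ⊢
    rwa [det_transpose]
  rw [hu.mul_left_eq_zero, hu'.mul_right_eq_zero] at h0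
  exact h0

/-- The Dikin ellipsoid: the local unit ball around `P` stays in the positive definite cone. -/
lemma posDef_add_of_localForm_lt {P X : Matrix N N ℝ} (hP : P.PosDef) (hX : X.IsSymm)
    (h : localForm P X X < 1) : (P + X).PosDef := by
  obtain ⟨D, hu, hD1, hD⟩ := exists_transpose_mul_mul_eq_one hP
  rw [localForm_eq_trace hD] at h
  have h2 := posDef_one_add (isSymm_transpose_mul_mul hX D) h
  rw [← hD1, ← add_mul, ← mul_add] at h2
  rw [← IsUnit.posDef_star_left_conjugate_iff hu]
  simpa [star_eq_conjTranspose, conjTranspose_eq_transpose_of_trivial] using h2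

lemma posSemidef_add_of_localForm_le {P X : Matrix N N ℝ} (hP : P.PosDef) (hX : X.IsSymm)
    (h : localForm P X X ≤ 1) : (P + X).PosSemidef := by
  obtain ⟨D, hu, hD1, hD⟩ := exists_transpose_mul_mul_eq_one hP
  rw [localForm_eq_trace hD] at h
  have h2 := posSemidef_one_add (isSymm_transpose_mul_mul hX D) h
  rw [← hD1, ← add_mul, ← mul_add] at h2
  rw [← IsUnit.posSemidef_star_left_conjugate_iff hu]
  simpa [star_eq_conjTranspose, conjTranspose_eq_transpose_of_trivial] using h2

/-- In a cone direction the local norm is at most the pairing with the negative gradient `P⁻¹`. -/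
lemma localForm_self_le_sq_trace {P X : Matrix N N ℝ} (hP : P.PosDef) (hX : X.PosSemidef) :
    localForm P X X ≤ (P⁻¹ * X).trace ^ 2 := by
  obtain ⟨D, hu, -, hD⟩ := exists_transpose_mul_mul_eq_one hP
  have h1 : (P⁻¹ * X).trace = (Dᵀ * X * D).trace := by
    rw [hD, mul_assoc, trace_mul_comm]
  rw [localForm_eq_trace hD, h1]
  refine trace_mul_self_le_sq_trace ?_
  simpa [conjTranspose_eq_transpose_of_trivial] using hX.conjTranspose_mul_mul_same D

/-- If `V` represents the functional `tr (P⁻¹ ·)` in the local inner product at `Q`, tested against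
`V - Q` only, and `Q` lies in the unit ball of the local inner product at `P`, then `V` is
positive semidefinite. -/
lemma posSemidef_of_localForm_sub_le {P Q V : Matrix N N ℝ} (hP : P.PosDef) (hQs : Q.IsSymm)
    (hV : V.IsSymm) (h : localForm P (Q - P) (Q - P) < 1)
    (hVQ : localForm Q V (V - Q) = (P⁻¹ * (V - Q)).trace) : V.PosSemidef := by
  have hPs : P.IsSymm := (conjTranspose_eq_transpose_of_trivial P).symm.trans hP.1.eq
  have hQ : Q.PosDef := by simpa using posDef_add_of_localForm_lt hP (hQs.sub hPs) h
  have hPu : IsUnit P.det := (isUnit_iff_isUnit_det _).mp hP.isUnit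
  have hQu : IsUnit Q.det := (isUnit_iff_isUnit_det _).mp hQ.isUnit
  have hP1 : P⁻¹ * P = 1 := nonsing_inv_mul _ hPu
  have hQ1 : Q⁻¹ * Q = 1 := nonsing_inv_mul _ hQu
  have hQ2 : Q * Q⁻¹ = 1 := mul_nonsing_inv _ hQu
  -- `F` represents the functional `tr ((P⁻¹ - Q⁻¹) ·)` in the local inner product at `Q`. Its local
  -- norm at `Q` equals that of `Q - P` at `P`, and pairing it with `E = V - Q` gives the squared
  -- norm of `E`. Cauchy–Schwarz then puts `V` in the local unit ball at `Q`.
  set F := Q * P⁻¹ * Q - Q with hF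
  have hFs : F.IsSymm := by
    simp [hF, IsSymm, transpose_mul, hQs.eq, transpose_nonsing_inv, hPs.eq, mul_assoc]
  have hQF : Q⁻¹ * F = P⁻¹ * Q - 1 := by
    rw [hF, mul_sub, ← mul_assoc, ← mul_assoc, hQ1, one_mul]
  have hFF : localForm Q F F = localForm P (Q - P) (Q - P) := by
    rw [localForm, localForm, mul_assoc _ _ F, hQF, mul_assoc _ _ (Q - P), mul_sub P⁻¹, hP1]
  have hFE : localForm Q F (V - Q) = localForm Q (V - Q) (V - Q) := by
    have h1 : localForm Q (V - Q) (V - Q) =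
        localForm Q V (V - Q) - (Q⁻¹ * (V - Q)).trace := by
      rw [localForm, localForm, ← trace_sub, ← sub_mul, mul_sub Q⁻¹ V Q, hQ1, sub_mul, one_mul]
    rw [h1, hVQ, localForm, hQF, ← trace_sub, ← sub_mul, sub_mul, mul_assoc P⁻¹, hQ2, mul_one,
      one_mul]
  have hE : (V - Q).IsSymm := hV.sub hQs
  have hcs := sq_localForm_le hQ hFs hE
  rw [hFE, hFF] at hcs
  have hnn := localForm_self_nonneg hQ hE
  have : localForm Q (V - Q) (V - Q) ≤ 1 := by
    by_contra! hlt
    nlinarith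
  simpa using posSemidef_add_of_localForm_le hQ hE this

end MatrixForm

/-! ### Gradient and Hessian of a log-det barrier composed with a linear map. -/

section BarrierCalculus

open Matrix Filter Topology
open scoped Matrix.Norms.Operator

variable {N : Type*} [Fintype N] [DecidableEq N]

lemma hasDerivAt_det_one_add_smul (M : Matrix N N ℝ) :
    HasDerivAt (fun s : ℝ => (1 + s • M).det) M.trace 0 := by
  have h := (det (1 + (X : ℝ[X]) • M.map C)).hasDerivAt 0
  rw [derivative_det_one_add_X_smul] at h
  refine h.congr_of_eventuallyEq (.of_forall fun s => ?_)
  simp only [eval_det]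
  congr 1
  ext i j
  by_cases hij : i = j <;> simp [one_apply, hij, mul_comm]

variable {E : Type*} [NormedAddCommGroup E] [InnerProductSpace ℝ E] [FiniteDimensional ℝ E]

lemma differentiable_det_comp (A : E →ₗ[ℝ] Matrix N N ℝ) :
    Differentiable ℝ fun y => (A y).det := by
  have h : ∀ i j, Differentiable ℝ fun y => A y i j := fun i j =>
    (LinearMap.toContinuousLinearMap (entryLinearMap ℝ ℝ i j ∘ₗ A)).differentiable
  simp only [det_apply]
  fun_prop

lemma fderiv_det_comp (A : E →ₗ[ℝ] Matrix N N ℝ) {y : E} (hy : IsUnit (A y).det) (h : E) :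
    fderiv ℝ (fun y => (A y).det) y h = (A y).det * ((A y)⁻¹ * A h).trace := by
  have h1 : HasDerivAt (fun s : ℝ => (A (y + s • h)).det)
      (fderiv ℝ (fun y => (A y).det) y h) 0 :=
    ((differentiable_det_comp A) y).hasFDerivAt.hasLineDerivAt h
  have h2 := (hasDerivAt_det_one_add_smul ((A y)⁻¹ * A h)).const_mul (A y).det
  refine h1.unique (h2.congr_of_eventuallyEq (.of_forall fun s => ?_))
  simp only [map_add, map_smul]
  rw [← det_mul, mul_add, mul_one, mul_smul_comm, mul_nonsing_inv_cancel_left _ _ hy]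

/-- The log-det barrier pulled back along a linear map. -/
def logDetBarrier (A : E →ₗ[ℝ] Matrix N N ℝ) (x : E) : ℝ :=
  -Real.log (A x).det

lemma inner_gradient_logDetBarrier (A : E →ₗ[ℝ] Matrix N N ℝ) {y : E} (hy : IsUnit (A y).det)
    (h : E) : inner ℝ (gradient (logDetBarrier A) y) h = -((A y)⁻¹ * A h).trace := by
  have h0 : (A y).det ≠ 0 := hy.ne_zero
  rw [gradient, InnerProductSpace.toDual_symm_apply]
  have h1 := ((differentiable_det_comp A y).hasFDerivAt.log h0).neg.fderiv
  have h2 : logDetBarrier A = -fun y => Real.log (A y).det := rfl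
  rw [h2, h1]
  simp only [_root_.neg_apply, _root_.smul_apply, fderiv_det_comp A hy,
    smul_eq_mul]
  field_simp

lemma hasFDerivAt_inv_comp (A : E →ₗ[ℝ] Matrix N N ℝ) {x : E} (hx : IsUnit (A x).det) :
    ∃ T : E →L[ℝ] Matrix N N ℝ, (∀ h, T h = -((A x)⁻¹ * A h * (A x)⁻¹)) ∧
      HasFDerivAt (fun y => (A y)⁻¹) T x := by
  obtain ⟨u, hu⟩ := (isUnit_iff_isUnit_det _).mpr hx
  have h1 : HasFDerivAt (fun y => A y) (LinearMap.toContinuousLinearMap A) x :=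
    (LinearMap.toContinuousLinearMap A).hasFDerivAt
  have h2 := hasFDerivAt_ringInverse (𝕜 := ℝ) u
  rw [hu] at h2
  refine ⟨_, fun h => ?_, (h2.comp x h1).congr_of_eventuallyEq
    (.of_forall fun y => nonsing_inv_eq_ringInverse (A y))⟩
  have h3 : ((u⁻¹ : (Matrix N N ℝ)ˣ) : Matrix N N ℝ) = (A x)⁻¹ := by
    rw [nonsing_inv_eq_ringInverse, ← hu, Ring.inverse_unit]
  change -(((u⁻¹ : (Matrix N N ℝ)ˣ) : Matrix N N ℝ) * A h * ((u⁻¹ : (Matrix N N ℝ)ˣ) : Matrix N N ℝ))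
    = _
  rw [h3]

lemma eventually_isUnit_det (A : E →ₗ[ℝ] Matrix N N ℝ) {x : E} (hx : IsUnit (A x).det) :
    ∀ᶠ y in 𝓝 x, IsUnit (A y).det := by
  simp only [isUnit_iff_ne_zero] at hx ⊢
  exact (differentiable_det_comp A).continuous.continuousAt.eventually_ne hx

lemma differentiableAt_gradient_logDetBarrier (A : E →ₗ[ℝ] Matrix N N ℝ) {x : E}
    (hx : IsUnit (A x).det) : DifferentiableAt ℝ (gradient (logDetBarrier A)) x := by
  obtain ⟨T, -, hT⟩ := hasFDerivAt_inv_comp A hx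
  let b := stdOrthonormalBasis ℝ E
  -- The gradient is known only through its inner products, so it is expanded in an orthonormal
  -- basis to see that it is differentiable.
  have h1 : (gradient (logDetBarrier A)) =ᶠ[𝓝 x]
      fun y => ∑ i, (-((A y)⁻¹ * A (b i)).trace) • b i := by
    filter_upwards [eventually_isUnit_det A hx] with y hy
    rw [← b.sum_repr (gradient (logDetBarrier A) y)]
    refine Finset.sum_congr rfl fun i _ => ?_
    rw [b.repr_apply_apply, real_inner_comm, inner_gradient_logDetBarrier A hy]
  refine DifferentiableAt.congr_of_eventuallyEq ?_ h1
  refine DifferentiableAt.fun_sum fun i _ => DifferentiableAt.smul_const ?_ _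
  let τ : Matrix N N ℝ →ₗ[ℝ] ℝ := traceLinearMap N ℝ ℝ ∘ₗ LinearMap.mulRight ℝ (A (b i))
  exact ((LinearMap.toContinuousLinearMap τ).differentiableAt.comp x hT.differentiableAt).neg

lemma inner_fderiv_gradient_logDetBarrier (A : E →ₗ[ℝ] Matrix N N ℝ) {x : E}
    (hx : IsUnit (A x).det) (h k : E) :
    inner ℝ (fderiv ℝ (gradient (logDetBarrier A)) x h) k = localForm (A x) (A h) (A k) := by
  obtain ⟨T, hT1, hT⟩ := hasFDerivAt_inv_comp A hx
  let τ : Matrix N N ℝ →L[ℝ] ℝ :=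
    LinearMap.toContinuousLinearMap (traceLinearMap N ℝ ℝ ∘ₗ LinearMap.mulRight ℝ (A k))
  have h1 : HasFDerivAt (fun y => -((A y)⁻¹ * A k).trace) (-(τ ∘L T)) x :=
    ((τ.hasFDerivAt (x := (A x)⁻¹)).comp x hT).neg
  have h2 : HasFDerivAt (fun y => inner ℝ (gradient (logDetBarrier A) y) k)
      ((innerSL ℝ k) ∘L fderiv ℝ (gradient (logDetBarrier A)) x) x := by
    have := ((innerSL ℝ k).hasFDerivAt
      (x := gradient (logDetBarrier A) x)).comp x
      (differentiableAt_gradient_logDetBarrier A hx).hasFDerivAt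
    refine this.congr_of_eventuallyEq (.of_forall fun y => ?_)
    simp [real_inner_comm k]
  have h3 := h2.unique (h1.congr_of_eventuallyEq (by
    filter_upwards [eventually_isUnit_det A hx] with y hy
    exact inner_gradient_logDetBarrier A hy k))
  have h4 := congrArg (fun S : E →L[ℝ] ℝ => S h) h3
  simp only [ContinuousLinearMap.comp_apply, innerSL_apply_apply, _root_.neg_apply,
    hT1] at h4
  rw [real_inner_comm, h4]
  simp [τ, localForm]

end BarrierCalculus

/-! ### Coefficient vectors, moment functionals and point evaluations. -/

lemma isClosed_dualCone {m : ℕ} (w : Fin m → ℝ[X]) (L : Fin m → ℕ) (U : ℕ) :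
    IsClosed (dualCone w L U) :=
  (ProperCone.innerDual (cone w L U)).isClosed

/-- The linear functional `X ^ u ↦ x u` on polynomials. -/
def moment {U : ℕ} (x : EuclideanSpace ℝ (Fin U)) : ℝ[X] →ₗ[ℝ] ℝ where
  toFun q := ∑ u : Fin U, q.coeff u * x u
  map_add' a b := by simp [add_mul, Finset.sum_add_distrib]
  map_smul' c a := by simp [mul_assoc, Finset.mul_sum]

lemma moment_apply {U : ℕ} (x : EuclideanSpace ℝ (Fin U)) (q : ℝ[X]) :
    moment x q = ∑ u : Fin U, q.coeff u * x u := rfl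

lemma coeff_toPoly {U : ℕ} (s : EuclideanSpace ℝ (Fin U)) (u : Fin U) :
    (toPoly s).coeff u = s u := by
  simp only [toPoly, finsetSum_coeff, coeff_C_mul_X_pow]
  simp [Fin.val_inj]

lemma inner_eq_moment {U : ℕ} (s x : EuclideanSpace ℝ (Fin U)) :
    inner ℝ s x = moment x (toPoly s) := by
  simp only [moment_apply, coeff_toPoly, PiLp.inner_apply, RCLike.inner_apply, conj_trivial]
  exact Finset.sum_congr rfl fun _ _ => mul_comm _ _

lemma toPoly_coeffVec {U : ℕ} {q : ℝ[X]} (hq : q ∈ degreeLT ℝ U) : toPoly (coeffVec U q) = q := by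
  ext k
  rw [mem_degreeLT] at hq
  by_cases hk : k < U
  · exact coeff_toPoly (coeffVec U q) ⟨k, hk⟩
  · rw [coeff_eq_zero_of_degree_lt (hq.trans_le (by exact_mod_cast not_lt.mp hk))]
    simp only [toPoly, finsetSum_coeff, coeff_C_mul_X_pow]
    exact Finset.sum_eq_zero fun u _ => if_neg (by lia)

/-- The vector `q(z) = (1, z, …, z^{U-1})`. -/
def powerVec (U : ℕ) (z : ℝ) : EuclideanSpace ℝ (Fin U) :=
  WithLp.toLp 2 fun u => z ^ (u : ℕ)

lemma moment_powerVec {U : ℕ} (z : ℝ) {q : ℝ[X]} (hq : q ∈ degreeLT ℝ U) :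
    moment (powerVec U z) q = q.eval z := by
  exact (eval_eq_sum_degreeLTEquiv hq z).symm

/-! ### The dual cone, its barrier, and dual certificates for general weights. -/

section Cone

variable {m : ℕ} {w : Fin m → ℝ[X]} {L : Fin m → ℕ} {U : ℕ}

lemma mem_dualCone_iff
    (hw : ∀ i, ∀ a ∈ degreeLT ℝ (L i), ∀ b ∈ degreeLT ℝ (L i), w i * a * b ∈ degreeLT ℝ U)
    {x : EuclideanSpace ℝ (Fin U)} :
    x ∈ dualCone w L U ↔ ∀ i, ∀ r ∈ degreeLT ℝ (L i), 0 ≤ moment x (w i * r * r) := by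
  simp only [dualCone, SetLike.mem_coe, ProperCone.mem_innerDual]
  constructor
  · intro h i r hr
    have hs : coeffVec U (w i * r * r) ∈ cone w L U := by
      refine ⟨Function.update 0 i (r ^ 2), fun j => ?_, ?_⟩
      · by_cases hj : j = i
        · subst hj
          exact ⟨1, fun _ => r, fun _ => hr, by simp⟩
        · exact ⟨0, Fin.elim0, fun j => j.elim0, by simp [hj]⟩
      · rw [toPoly_coeffVec (hw i r hr r hr), Finset.sum_eq_single i]
        · simp [sq, mul_assoc]
        · intro j _ hj; simp [hj]
        · simp
    have := h hs
    rwa [inner_eq_moment, toPoly_coeffVec (hw i r hr r hr)] at this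
  · rintro h s ⟨σ, hσ, hs⟩
    rw [inner_eq_moment, hs, map_sum]
    refine Finset.sum_nonneg fun i _ => ?_
    obtain ⟨k, r, hr, hk⟩ := hσ i
    rw [hk, Finset.mul_sum, map_sum]
    refine Finset.sum_nonneg fun j _ => ?_
    rw [sq, ← mul_assoc]
    exact h i _ (hr j)

lemma inner_nonneg_of_mem {s x : EuclideanSpace ℝ (Fin U)} (hs : s ∈ closure (cone w L U))
    (hx : x ∈ dualCone w L U) : 0 ≤ inner ℝ s x := by
  have hc : IsClosed {s : EuclideanSpace ℝ (Fin U) | 0 ≤ inner ℝ s x} :=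
    isClosed_le continuous_const (by fun_prop)
  refine closure_minimal (fun s hs => ?_) hc hs
  simp only [dualCone, SetLike.mem_coe, ProperCone.mem_innerDual] at hx
  exact hx hs

/-- Moving from `t` by a fixed distance in the direction `-x` stays in the cone, and the result
pairs nonnegatively with `x`. This coercivity gives compact slices of the dual cone and injectivity
of `Λ`. -/
lemma exists_mul_norm_le_inner {t : EuclideanSpace ℝ (Fin U)} (ht : t ∈ interior (cone w L U)) :
    ∃ δ > 0, ∀ x ∈ dualCone w L U, δ * ‖x‖ ≤ inner ℝ t x := by
  obtain ⟨δ, hδ, hball⟩ := Metric.isOpen_iff.mp isOpen_interior t ht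
  refine ⟨δ / 2, by positivity, fun x hx => ?_⟩
  rcases eq_or_ne x 0 with rfl | hx0
  · simp
  have hxn : 0 < ‖x‖ := norm_pos_iff.mpr hx0
  have hmem : t - (δ / 2 / ‖x‖) • x ∈ cone w L U := by
    refine interior_subset (hball ?_)
    rw [Metric.mem_ball, dist_eq_norm, sub_sub_cancel_left, norm_neg, norm_smul, Real.norm_eq_abs,
      abs_of_pos (by positivity), div_mul_cancel₀ _ hxn.ne']
    linarith
  have h := inner_nonneg_of_mem (subset_closure hmem) hx
  rw [inner_sub_left, real_inner_smul_left, real_inner_self_eq_norm_sq] at h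
  have h2 : δ / 2 / ‖x‖ * ‖x‖ ^ 2 = δ / 2 * ‖x‖ := by field_simp
  linarith

variable (w) (U) (p : ∀ i, Module.Basis (Fin (L i)) ℝ (degreeLT ℝ (L i)))

/-- The map `Λ`, as a linear map. -/
def lambdaMap : EuclideanSpace ℝ (Fin U) →ₗ[ℝ]
    Matrix (Σ i : Fin m, Fin (L i)) (Σ i : Fin m, Fin (L i)) ℝ where
  toFun := lambda w U p
  map_add' x y := by
    rw [lambda, lambda, lambda, ← Matrix.blockDiagonal'_add]
    congr 1
    ext i j k
    simp [lambdaBlock, mul_add, Finset.sum_add_distrib]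
  map_smul' c x := by
    rw [lambda, lambda, RingHom.id_apply, ← Matrix.blockDiagonal'_smul]
    congr 1
    ext i j k
    simp [lambdaBlock, Finset.mul_sum, mul_left_comm]

lemma lambdaMap_isSymm (x : EuclideanSpace ℝ (Fin U)) : (lambdaMap w U p x).IsSymm := by
  change (lambda w U p x).IsSymm
  rw [Matrix.IsSymm, lambda, Matrix.blockDiagonal'_transpose]
  congr 1
  ext i j k
  simp only [lambdaBlock, Matrix.transpose_apply, Matrix.of_apply]
  exact Finset.sum_congr rfl fun u _ => by rw [mul_right_comm]

lemma dotProduct_lambdaMap_mulVec (x : EuclideanSpace ℝ (Fin U))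
    (v : (Σ i : Fin m, Fin (L i)) → ℝ) :
    v ⬝ᵥ (lambdaMap w U p x).mulVec v =
      ∑ i, moment x (w i * (∑ j, v ⟨i, j⟩ • (p i j : ℝ[X])) * (∑ j, v ⟨i, j⟩ • (p i j : ℝ[X]))) := by
  change v ⬝ᵥ (lambda w U p x).mulVec v = _
  simp only [dotProduct, Matrix.mulVec, Fintype.sum_sigma, lambda]
  refine Finset.sum_congr rfl fun i _ => ?_
  rw [mul_assoc, Finset.sum_mul, Finset.mul_sum, map_sum]
  refine Finset.sum_congr rfl fun j _ => ?_
  rw [Finset.sum_eq_single i]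
  · rw [Finset.mul_sum, Finset.mul_sum, Finset.mul_sum, map_sum]
    refine Finset.sum_congr rfl fun k _ => ?_
    rw [Matrix.blockDiagonal'_apply_eq, lambdaBlock, Matrix.of_apply]
    simp only [mul_smul_comm, smul_mul_assoc, map_smul, smul_eq_mul, moment_apply, ← mul_assoc]
    ring
  · intro i' _ hi'
    exact Finset.sum_eq_zero fun k _ => by
      rw [Matrix.blockDiagonal'_apply_ne _ _ _ hi'.symm, zero_mul]
  · simp

lemma lambdaMap_isHermitian (x : EuclideanSpace ℝ (Fin U)) : (lambdaMap w U p x).IsHermitian :=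
  (Matrix.conjTranspose_eq_transpose_of_trivial _).trans (lambdaMap_isSymm w U p x)

variable {w U}

lemma posSemidef_lambdaMap_iff
    (hw : ∀ i, ∀ a ∈ degreeLT ℝ (L i), ∀ b ∈ degreeLT ℝ (L i), w i * a * b ∈ degreeLT ℝ U)
    {x : EuclideanSpace ℝ (Fin U)} :
    (lambdaMap w U p x).PosSemidef ↔ x ∈ dualCone w L U := by
  rw [mem_dualCone_iff hw]
  constructor
  · intro h i r hr
    have h1 := h.dotProduct_mulVec_nonneg fun ij =>
      if ij.1 = i then (p ij.1).repr (if hi : ij.1 = i then ⟨r, hi ▸ hr⟩ else 0) ij.2 else 0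
    rw [star_trivial, dotProduct_lambdaMap_mulVec, Finset.sum_eq_single i] at h1
    · simp only [if_true, dif_pos] at h1
      have h2 : ∑ j, ((p i).repr ⟨r, hr⟩ j) • (p i j : ℝ[X]) = r := by
        have := congrArg Subtype.val ((p i).sum_repr ⟨r, hr⟩)
        rwa [AddSubmonoidClass.coe_finsetSum] at this
      rwa [h2] at h1
    · intro j _ hj
      simp [hj]
    · simp
  · intro h
    refine .of_dotProduct_mulVec_nonneg (lambdaMap_isHermitian w U p x) fun v => ?_
    rw [star_trivial, dotProduct_lambdaMap_mulVec]
    refine Finset.sum_nonneg fun i _ => h i _ ?_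
    exact Submodule.sum_mem _ fun j _ => Submodule.smul_mem _ _ (p i j).2

lemma posDef_lambdaMap {x : EuclideanSpace ℝ (Fin U)}
    (h : ∀ i, ∀ r ∈ degreeLT ℝ (L i), r ≠ 0 → 0 < moment x (w i * r * r)) :
    (lambdaMap w U p x).PosDef := by
  refine .of_dotProduct_mulVec_pos (lambdaMap_isHermitian w U p x) fun v hv => ?_
  rw [star_trivial, dotProduct_lambdaMap_mulVec]
  have hmem : ∀ i, ∑ j, v ⟨i, j⟩ • (p i j : ℝ[X]) ∈ degreeLT ℝ (L i) := fun i =>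
    Submodule.sum_mem _ fun j _ => Submodule.smul_mem _ _ (p i j).2
  refine Finset.sum_pos' (fun i _ => ?_) ?_
  · by_cases h0 : ∑ j, v ⟨i, j⟩ • (p i j : ℝ[X]) = 0
    · simp [h0]
    · exact (h i _ (hmem i) h0).le
  · obtain ⟨⟨i, j⟩, hij⟩ := Function.ne_iff.mp hv
    refine ⟨i, Finset.mem_univ _, h i _ (hmem i) fun h0 => hij ?_⟩
    have h1 : ∑ j, v ⟨i, j⟩ • p i j = 0 := by
      apply Subtype.ext
      simpa using h0
    exact Fintype.linearIndependent_iff.mp (p i).linearIndependent _ h1 j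

lemma continuous_localForm_lambdaMap
    (P : Matrix (Σ i : Fin m, Fin (L i)) (Σ i : Fin m, Fin (L i)) ℝ)
    (y : EuclideanSpace ℝ (Fin U)) :
    Continuous fun z => localForm P (lambdaMap w U p (z - y)) (lambdaMap w U p (z - y)) := by
  have h : Continuous fun z => lambdaMap w U p (z - y) :=
    (LinearMap.continuous_of_finiteDimensional _).comp (continuous_id.sub continuous_const)
  unfold localForm
  exact ((continuous_const.matrix_mul h).matrix_mul continuous_const |>.matrix_mul h).matrix_trace

lemma mem_interior_dualCone
    (hw : ∀ i, ∀ a ∈ degreeLT ℝ (L i), ∀ b ∈ degreeLT ℝ (L i), w i * a * b ∈ degreeLT ℝ U)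
    {y : EuclideanSpace ℝ (Fin U)} (hy : (lambdaMap w U p y).PosDef) :
    y ∈ interior (dualCone w L U) := by
  refine mem_interior.mpr ⟨_, fun z hz => ?_,
    isOpen_lt (continuous_localForm_lambdaMap (w := w) p (lambdaMap w U p y) y)
      (continuous_const (y := (1 : ℝ))), by simp [localForm]⟩
  rw [← posSemidef_lambdaMap_iff p hw]
  have := posDef_add_of_localForm_lt hy (lambdaMap_isSymm w U p (z - y)) hz
  rw [← map_add, add_sub_cancel] at this
  exact this.posSemidef

/-- If `Λ(x) = 0`, both `x` and `-x` lie in the dual cone, so coercivity of `t` applied to each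
forces `x = 0`. -/
lemma lambdaMap_injective
    (hw : ∀ i, ∀ a ∈ degreeLT ℝ (L i), ∀ b ∈ degreeLT ℝ (L i), w i * a * b ∈ degreeLT ℝ U)
    {t : EuclideanSpace ℝ (Fin U)} (ht : t ∈ interior (cone w L U)) :
    Function.Injective (lambdaMap w U p) := by
  rw [injective_iff_map_eq_zero]
  intro x hx
  obtain ⟨δ, hδ, h⟩ := exists_mul_norm_le_inner ht
  have h1 : x ∈ dualCone w L U := by
    rw [← posSemidef_lambdaMap_iff p hw, hx]; exact .zero
  have h2 : -x ∈ dualCone w L U := by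
    rw [← posSemidef_lambdaMap_iff p hw, map_neg, hx, neg_zero]; exact .zero
  have h3 := h _ h1
  have h4 := h _ h2
  rw [norm_neg, inner_neg_right] at h4
  exact norm_le_zero_iff.mp (by nlinarith)

lemma inner_hessian {y : EuclideanSpace ℝ (Fin U)} (hy : (lambdaMap w U p y).PosDef)
    (h k : EuclideanSpace ℝ (Fin U)) :
    inner ℝ (hessian w U p y h) k =
      localForm (lambdaMap w U p y) (lambdaMap w U p h) (lambdaMap w U p k) :=
  inner_fderiv_gradient_logDetBarrier _ hy.det_pos.ne'.isUnit h k

lemma isInvertible_hessian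
    (hinj : Function.Injective (lambdaMap w U p))
    {y : EuclideanSpace ℝ (Fin U)} (hy : (lambdaMap w U p y).PosDef) :
    (hessian w U p y).IsInvertible := by
  have h : Function.Injective (hessian w U p y).toLinearMap := by
    rw [injective_iff_map_eq_zero]
    intro a ha
    have h1 := inner_hessian p hy a a
    rw [ContinuousLinearMap.coe_coe] at ha
    rw [ha, inner_zero_left] at h1
    exact (injective_iff_map_eq_zero _).mp hinj a
      (eq_zero_of_localForm_self_eq_zero hy (lambdaMap_isSymm w U p a) h1.symm)
  exact ⟨(LinearEquiv.ofInjectiveEndo _ h).toContinuousLinearEquiv, by ext; rfl⟩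

/-- Every point of the open unit ball, in the local norm, around a point `x` whose gradient is a
negative multiple of `t` is a dual certificate of `t`. -/
theorem isDualCertificate_of_localForm_lt
    (hw : ∀ i, ∀ a ∈ degreeLT ℝ (L i), ∀ b ∈ degreeLT ℝ (L i), w i * a * b ∈ degreeLT ℝ U)
    {t x y : EuclideanSpace ℝ (Fin U)} {c : ℝ} (hc : 0 < c) (ht : t ∈ interior (cone w L U))
    (hx : (lambdaMap w U p x).PosDef)
    (htx : ∀ k, inner ℝ t k = c * ((lambdaMap w U p x)⁻¹ * lambdaMap w U p k).trace)
    (hy : localForm (lambdaMap w U p x) (lambdaMap w U p (y - x)) (lambdaMap w U p (y - x)) < 1) :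
    IsDualCertificate w U p y t := by
  have hyx := posDef_add_of_localForm_lt hx (lambdaMap_isSymm w U p _) hy
  rw [← map_add, add_sub_cancel] at hyx
  have hinv := isInvertible_hessian p (lambdaMap_injective p hw ht) hyx
  refine ⟨interior_subset ht, mem_interior_dualCone p hw hyx, hinv, ?_⟩
  set v := (hessian w U p y).inverse t with hv
  have hHv : hessian w U p y v = t := hinv.self_apply_inverse t
  rw [← posSemidef_lambdaMap_iff p hw]
  have hcv : lambdaMap w U p v = c • lambdaMap w U p (c⁻¹ • v) := by
    rw [map_smul, smul_inv_smul₀ hc.ne']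
  rw [hcv]
  refine Matrix.PosSemidef.smul ?_ hc.le
  -- Here `V = Λ(c⁻¹ v)` with `H(y) v = t`. The representation of `tr (Λ(x)⁻¹ ·)` is available only
  -- on the range of `Λ`, which suffices because `V - Λ(y)` lies in it.
  refine posSemidef_of_localForm_sub_le hx (lambdaMap_isSymm w U p y)
    (lambdaMap_isSymm w U p _) (by rwa [← map_sub]) ?_
  rw [← map_sub, ← inner_hessian p hyx, map_smul, hHv, real_inner_smul_left, htx,
    inv_mul_cancel_left₀ hc.ne']

/-- A point in the interior of the cone is minus the gradient of the barrier at some point. -/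
theorem exists_trace_inv_mul_eq_inner [Nonempty (Σ i : Fin m, Fin (L i))]
    (hw : ∀ i, ∀ a ∈ degreeLT ℝ (L i), ∀ b ∈ degreeLT ℝ (L i), w i * a * b ∈ degreeLT ℝ U)
    {t x₀ : EuclideanSpace ℝ (Fin U)} (ht : t ∈ interior (cone w L U))
    (hx₀ : (lambdaMap w U p x₀).PosDef) :
    ∃ x, (lambdaMap w U p x).PosDef ∧
      ∀ k, inner ℝ t k = ((lambdaMap w U p x)⁻¹ * lambdaMap w U p k).trace := by
  obtain ⟨δ, hδ, hb⟩ := exists_mul_norm_le_inner ht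
  set ν : ℝ := Nat.cast (Fintype.card (Σ i : Fin m, Fin (L i))) with hν
  have hνpos : 0 < ν := by rw [hν]; exact_mod_cast Fintype.card_pos
  have hx₀d : x₀ ∈ dualCone w L U := (posSemidef_lambdaMap_iff p hw).mp hx₀.posSemidef
  have hx₀0 : x₀ ≠ 0 := by
    rintro rfl
    have := hx₀.trace_pos
    simp at this
  have htx₀ : 0 < inner ℝ t x₀ :=
    (mul_pos hδ (norm_pos_iff.mpr hx₀0)).trans_le (hb x₀ hx₀d)
  -- Maximise the determinant on the slice `⟪t, x⟫ = ν`, with `ν` the size of `Λ`. Criticality makes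
  -- `tr (Λ(x)⁻¹ Λ(·))` vanish on the orthogonal complement of `t`, hence proportional to `⟪t, ·⟫`;
  -- testing at `x` itself, where `tr 1 = ν`, shows that the factor is `1`.
  let K : Set (EuclideanSpace ℝ (Fin U)) := {x | x ∈ dualCone w L U ∧ inner ℝ t x = ν}
  have hKc : IsCompact K := by
    refine Metric.isCompact_of_isClosed_isBounded ?_ ?_
    · exact (isClosed_dualCone w L U).inter (isClosed_eq (by fun_prop) continuous_const)
    · refine (Metric.isBounded_closedBall (x := 0) (r := ν / δ)).subset fun x hx => ?_
      rw [mem_closedBall_zero_iff, le_div_iff₀ hδ, mul_comm, ← hx.2]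
      exact hb x hx.1
  have hx₁ : (lambdaMap w U p ((ν / inner ℝ t x₀) • x₀)).PosDef := by
    rw [map_smul]
    exact hx₀.smul (by positivity)
  have hx₁K : (ν / inner ℝ t x₀) • x₀ ∈ K :=
    ⟨(posSemidef_lambdaMap_iff p hw).mp hx₁.posSemidef, by
      rw [real_inner_smul_right, div_mul_cancel₀ _ htx₀.ne']⟩
  obtain ⟨x, hxK, hmax⟩ := hKc.exists_isMaxOn ⟨_, hx₁K⟩
    (differentiable_det_comp (lambdaMap w U p)).continuous.continuousOn
  have hdet : 0 < (lambdaMap w U p x).det := hx₁.det_pos.trans_le (hmax hx₁K)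
  have hxpd : (lambdaMap w U p x).PosDef :=
    ((posSemidef_lambdaMap_iff p hw).mpr hxK.1).posDef_iff_det_ne_zero.mpr hdet.ne'
  refine ⟨x, hxpd, ?_⟩
  have hxint := mem_interior_dualCone p hw hxpd
  have hperp : ∀ h, inner ℝ t h = 0 →
      ((lambdaMap w U p x)⁻¹ * lambdaMap w U p h).trace = 0 := by
    intro h hth
    have hd : HasDerivAt (fun s : ℝ => (lambdaMap w U p (x + s • h)).det)
        (fderiv ℝ (fun y => (lambdaMap w U p y).det) x h) 0 :=
      ((differentiable_det_comp (lambdaMap w U p)) x).hasFDerivAt.hasLineDerivAt h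
    have hloc : IsLocalMax (fun s : ℝ => (lambdaMap w U p (x + s • h)).det) 0 := by
      have hc : Filter.Tendsto (fun s : ℝ => x + s • h) (nhds 0) (nhds x) := by
        have : Continuous fun s : ℝ => x + s • h := by fun_prop
        simpa using this.tendsto 0
      filter_upwards [hc (mem_interior_iff_mem_nhds.mp hxint)] with s hs
      simp only [zero_smul, add_zero]
      exact hmax ⟨hs, by rw [inner_add_right, real_inner_smul_right, hth, hxK.2]; ring⟩
    have h0 := hloc.hasDerivAt_eq_zero hd
    rw [fderiv_det_comp _ hdet.ne'.isUnit] at h0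
    exact (mul_eq_zero.mp h0).resolve_left hdet.ne'
  have hxx : ((lambdaMap w U p x)⁻¹ * lambdaMap w U p x).trace = ν := by
    rw [Matrix.nonsing_inv_mul _ hdet.ne'.isUnit, Matrix.trace_one]
  intro k
  have h1 := hperp (k - (inner ℝ t k / ν) • x) (by
    rw [inner_sub_right, real_inner_smul_right, hxK.2, div_mul_cancel₀ _ hνpos.ne', sub_self])
  rw [map_sub, map_smul, Matrix.mul_sub, Matrix.mul_smul, Matrix.trace_sub, Matrix.trace_smul, hxx,
    smul_eq_mul, div_mul_cancel₀ _ hνpos.ne'] at h1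
  linarith

end Cone

/-! ### Apéry numbers: recurrence and growth. -/

section Apery

/-- The absolute values of the coefficients of the shifted Legendre polynomials. -/
def legendreCoeff (n k : ℕ) : ℝ := n.choose k * (n + k).choose k

/-- The Apéry numbers `∑ k, (n choose k)² (n + k choose k)²`. -/
def apery (n : ℕ) : ℝ := ∑ k ∈ Finset.range (n + 1), legendreCoeff n k ^ 2

lemma legendreCoeff_of_lt {n k : ℕ} (h : n < k) : legendreCoeff n k = 0 := by
  simp [legendreCoeff, Nat.choose_eq_zero_of_lt h]

lemma legendreCoeff_eq {n k : ℕ} (h : k ≤ n) :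
    legendreCoeff n k = (n + k).factorial / ((k.factorial : ℝ) ^ 2 * (n - k).factorial) := by
  rw [legendreCoeff, Nat.cast_choose ℝ h, Nat.cast_choose ℝ (Nat.le_add_left k n),
    Nat.add_sub_cancel]
  have := Nat.factorial_ne_zero n
  field_simp

lemma apery_eq_sum {n N : ℕ} (h : n < N) :
    apery n = ∑ k ∈ Finset.range N, legendreCoeff n k ^ 2 := by
  refine Finset.sum_subset (by simpa using h) fun k _ hk => ?_
  rw [legendreCoeff_of_lt (by simpa using hk)]
  simp

lemma apery_pos (n : ℕ) : 0 < apery n := by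
  refine Finset.sum_pos' (fun _ _ => sq_nonneg _) ⟨0, by simp, by simp [legendreCoeff]⟩

/-- All the terms in the recurrence of the Apéry numbers are polynomial multiples of one number. -/
lemma exists_legendreCoeff_eq {n k : ℕ} (h : k ≤ n + 2) : ∃ f : ℝ,
    legendreCoeff n k = f * (n + 2 - k) * (n + 1 - k) ∧
    legendreCoeff (n + 1) k = f * (n + 1 + k) * (n + 2 - k) ∧
    legendreCoeff (n + 2) k = f * (n + 1 + k) * (n + 2 + k) ∧
    ∀ j, j + 1 = k → legendreCoeff (n + 1) j = f * k ^ 2 := by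
  refine ⟨(n + k).factorial / ((k.factorial : ℝ) ^ 2 * (n + 2 - k).factorial), ?_, ?_, ?_, ?_⟩
  · rcases Nat.lt_or_ge n k with hk | hk
    · rw [legendreCoeff_of_lt hk]
      obtain rfl | rfl : k = n + 1 ∨ k = n + 2 := by lia
      · push_cast; ring
      · push_cast; ring
    · obtain ⟨d, rfl⟩ := Nat.exists_eq_add_of_le hk
      rw [legendreCoeff_eq hk, show k + d + 2 - k = d + 2 by lia, show k + d - k = d by lia,
        Nat.factorial_succ (d + 1), Nat.factorial_succ d]
      push_cast
      field_simp
      ring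
  · rcases Nat.lt_or_ge (n + 1) k with hk | hk
    · rw [legendreCoeff_of_lt hk]
      obtain rfl : k = n + 2 := by lia
      push_cast; ring
    · obtain ⟨d, hd⟩ := Nat.exists_eq_add_of_le hk
      have hn : (n : ℝ) = k + d - 1 := by
        have : ((n + 1 : ℕ) : ℝ) = (k + d : ℕ) := by rw [hd]
        push_cast at this; linarith
      rw [legendreCoeff_eq hk, show n + 2 - k = d + 1 by lia, show n + 1 - k = d by lia,
        show n + 1 + k = (n + k) + 1 by lia, Nat.factorial_succ d, Nat.factorial_succ (n + k)]
      push_cast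
      rw [hn]
      field_simp
      ring
  · rw [legendreCoeff_eq h, show n + 2 + k = (n + k) + 1 + 1 by lia,
      Nat.factorial_succ (n + k + 1), Nat.factorial_succ (n + k)]
    push_cast
    field_simp
    ring
  · rintro j rfl
    rw [legendreCoeff_eq (by lia : j ≤ n + 1), show n + 2 - (j + 1) = n + 1 - j by lia,
      show n + 1 + j = n + (j + 1) by lia, Nat.factorial_succ j]
    push_cast
    field_simp

/-- Creative telescoping: the right-hand side is the certificate for the Apéry recurrence. At `m = n
+ 2` it vanishes because `legendreCoeff (n + 1) (n + 2) = 0`. -/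
lemma apery_partial_sum (n : ℕ) {m : ℕ} (hm : m ≤ n + 2) :
    ∑ k ∈ Finset.range (m + 1), (((n : ℝ) + 2) ^ 3 * legendreCoeff (n + 2) k ^ 2
      - (2 * n + 3) * (17 * (n + 1) ^ 2 + 17 * (n + 1) + 5) * legendreCoeff (n + 1) k ^ 2
      + (n + 1) ^ 3 * legendreCoeff n k ^ 2) =
    4 * (2 * n + 3) * (m * (2 * m + 1) - (2 * n + 3) ^ 2) * legendreCoeff (n + 1) m ^ 2 := by
  induction m with
  | zero =>
    simp [legendreCoeff]
    ring
  | succ m ih =>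
    rw [Finset.sum_range_succ, ih (by lia)]
    obtain ⟨f, h1, h2, h3, h4⟩ := exists_legendreCoeff_eq hm
    rw [h1, h2, h3, h4 m rfl]
    push_cast
    ring

lemma apery_recurrence (n : ℕ) :
    ((n : ℝ) + 2) ^ 3 * apery (n + 2) =
      (2 * n + 3) * (17 * (n + 1) ^ 2 + 17 * (n + 1) + 5) * apery (n + 1)
        - (n + 1) ^ 3 * apery n := by
  have h := apery_partial_sum n le_rfl
  rw [legendreCoeff_of_lt (Nat.lt_succ_self (n + 1)), Finset.sum_add_distrib,
    Finset.sum_sub_distrib, ← Finset.mul_sum, ← Finset.mul_sum, ← Finset.mul_sum,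
    ← apery_eq_sum (by lia), ← apery_eq_sum (by lia), ← apery_eq_sum (by lia)] at h
  linarith

lemma one_add_sqrt_two_pow_four : (1 + √2) ^ 4 = 17 + 12 * √2 := by
  have h : √2 ^ 2 = 2 := Real.sq_sqrt (by norm_num)
  linear_combination (√2 ^ 2 + 4 * √2 + 8) * h

/-- The growth rate of the Apéry numbers. -/
def aperyRate : ℝ := 17 + 12 * √2

lemma aperyRate_mul : aperyRate * (17 - 12 * √2) = 1 := by
  have h : √2 ^ 2 = 2 := Real.sq_sqrt (by norm_num)
  rw [aperyRate]
  linear_combination -144 * h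

lemma aperyRate_ge : 17 ≤ aperyRate := by
  rw [aperyRate]
  have := Real.sqrt_nonneg 2
  linarith

/-- The factor `(2m+1)/(2m+4) ≈ 1 - 3/(2m)` encodes the decay `m^(-3/2)` relative to `aperyRate ^
m`. The previous term enters the recurrence with a minus sign, so the induction hypothesis, read as
a lower bound for it, is what the step needs. -/
lemma apery_ratio (m : ℕ) :
    (2 * (m : ℝ) + 4) * apery (m + 1) ≤ aperyRate * (2 * m + 1) * apery m := by
  have hs : 0 ≤ √2 := Real.sqrt_nonneg 2
  have h2 : √2 ^ 2 = 2 := Real.sq_sqrt (by norm_num)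
  induction m with
  | zero =>
    have h0 : apery 0 = 1 := by simp [apery, legendreCoeff]
    have h1 : apery 1 = 5 := by
      simp [apery, legendreCoeff, Finset.sum_range_succ]
      norm_num
    rw [h0, h1, aperyRate]
    have : 1 ≤ √2 := Real.one_le_sqrt.mpr (by norm_num)
    push_cast
    linarith
  | succ m ih =>
    -- The other root of `x² - 34 x + 1`, the inverse of `aperyRate`.
    set β : ℝ := 17 - 12 * √2 with hβ
    have hβ0 : 0 < β := by
      have := aperyRate_mul
      exact pos_of_mul_pos_right (this.symm ▸ one_pos) (by linarith [aperyRate_ge])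
    have hm : (0 : ℝ) ≤ m := m.cast_nonneg
    have ih' : β * ((2 * m + 4) * apery (m + 1)) ≤ (2 * m + 1) * apery m := by
      have h := mul_le_mul_of_nonneg_left ih hβ0.le
      have h3 : β * (aperyRate * (2 * m + 1) * apery m) = (2 * m + 1) * apery m := by
        linear_combination (2 * m + 1) * apery m * aperyRate_mul
      rwa [h3] at h
    have hrec := apery_recurrence m
    have ha := apery_pos (m + 1)
    set a₁ := apery (m + 1)
    set a₀ := apery m
    change (2 * ((m + 1 : ℕ) : ℝ) + 4) * apery (m + 2) ≤ aperyRate * (2 * (m + 1 : ℕ) + 1) * a₁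
    set a₂ := apery (m + 2)
    push_cast
    have hpos : (0 : ℝ) < (m + 2) ^ 3 * (2 * m + 1) := by positivity
    refine le_of_mul_le_mul_left ?_ hpos
    have h4 : (2 * m + 6) * (m + 1 : ℝ) ^ 3 * (β * ((2 * m + 4) * a₁)) ≤
        (2 * m + 6) * (m + 1 : ℝ) ^ 3 * ((2 * m + 1) * a₀) :=
      mul_le_mul_of_nonneg_left ih' (by positivity)
    -- The slack left in the goal, multiplied by `(m+2)³(2m+1)`, after the recurrence and `h4` are
    -- used.
    have h5 : 0 ≤ (114 + (240 + 96 * √2) * m + (174 + 120 * √2) * m ^ 2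
        + (45 + 36 * √2) * m ^ 3) * a₁ := by positivity
    rw [aperyRate]
    rw [hβ] at h4
    linear_combination h4 + h5 + (2 * m + 6) * (2 * m + 1) * hrec

/-- Squaring avoids the exponent `3/2`. The step rests on `(2m+1)²(m+2) ≤ 4(m+1)³`, with difference
`3m + 2`. -/
lemma sq_apery_mul_le (m : ℕ) : apery m ^ 2 * ((m : ℝ) + 1) ^ 3 ≤ (aperyRate ^ m) ^ 2 := by
  induction m with
  | zero => simp [apery, legendreCoeff]
  | succ m ih =>
    have hm : (0 : ℝ) ≤ m := m.cast_nonneg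
    have ha := apery_pos m
    have hr := aperyRate_ge
    have h1 : ((2 * (m : ℝ) + 4) * apery (m + 1)) ^ 2 ≤ (aperyRate * (2 * m + 1) * apery m) ^ 2 :=
      pow_le_pow_left₀ (mul_nonneg (by positivity) (apery_pos _).le) (apery_ratio m) 2
    have h2 := mul_le_mul_of_nonneg_right h1 (by positivity : (0 : ℝ) ≤ m + 2)
    have h3 := mul_le_mul_of_nonneg_left ih (by positivity : (0 : ℝ) ≤ 4 * aperyRate ^ 2)
    have h4 : 0 ≤ aperyRate ^ 2 * apery m ^ 2 * (3 * m + 2) := by positivity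
    have h5 : (aperyRate ^ (m + 1)) ^ 2 = aperyRate ^ 2 * (aperyRate ^ m) ^ 2 := by ring
    rw [h5]
    push_cast
    nlinarith

lemma apery_mul_le (k : ℕ) :
    (2 * (k : ℝ) + 1) * apery k ≤ 2 * (aperyRate ^ k / √((k : ℝ) + 1)) := by
  have hk : (0 : ℝ) < k + 1 := by positivity
  have ha := apery_pos k
  have hr := aperyRate_ge
  have hs : 0 < √((k : ℝ) + 1) := Real.sqrt_pos.mpr hk
  have h1 : (k + 1) * apery k * √((k : ℝ) + 1) ≤ aperyRate ^ k := by
    refine (sq_le_sq₀ (by positivity) (by positivity)).mp ?_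
    rw [mul_pow, Real.sq_sqrt hk.le]
    calc _ = apery k ^ 2 * ((k : ℝ) + 1) ^ 3 := by ring
      _ ≤ _ := sq_apery_mul_le k
  rw [← le_div_iff₀ hs] at h1
  linarith

/-- The growth is geometric with ratio at least `17`, so the last term controls the sum. -/
lemma sum_apery_mul_le (n : ℕ) :
    ∑ k ∈ Finset.range (n + 1), (2 * (k : ℝ) + 1) * apery k ≤
      2 * (aperyRate ^ (n + 1) / √((n : ℝ) + 1)) := by
  have hr := aperyRate_ge
  induction n with
  | zero =>
    have h0 : apery 0 = 1 := by simp [apery, legendreCoeff]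
    simp [h0]
    linarith
  | succ n ih =>
    rw [Finset.sum_range_succ]
    refine (add_le_add ih (apery_mul_le (n + 1))).trans ?_
    push_cast
    have h1 : 0 < √((n : ℝ) + 1) := Real.sqrt_pos.mpr (by positivity)
    have h2 : 0 < √((n : ℝ) + 1 + 1) := Real.sqrt_pos.mpr (by positivity)
    have h3 : √((n : ℝ) + 1 + 1) ≤ 2 * √((n : ℝ) + 1) := by
      rw [Real.sqrt_le_left (by positivity), mul_pow, Real.sq_sqrt (by positivity)]
      have : (0 : ℝ) ≤ n := n.cast_nonneg
      linarith
    have h4 : 1 / √((n : ℝ) + 1) ≤ 2 / √((n : ℝ) + 1 + 1) := by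
      rw [div_le_div_iff₀ h1 h2]; linarith
    have h5 := mul_le_mul_of_nonneg_left h4 (by positivity : 0 ≤ aperyRate ^ (n + 1))
    have h6 : 0 ≤ aperyRate ^ (n + 1) / √((n : ℝ) + 1 + 1) := by positivity
    have h7 : aperyRate ^ (n + 1 + 1) / √((n : ℝ) + 1 + 1) =
        aperyRate * (aperyRate ^ (n + 1) / √((n : ℝ) + 1 + 1)) := by ring
    have h8 := mul_le_mul_of_nonneg_right hr h6
    rw [h7]
    rw [mul_one_div, mul_div_assoc', mul_comm _ (2 : ℝ), mul_div_assoc] at h5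
    linarith

end Apery

/-! ### Moments of the shifted Legendre polynomials by finite differences. -/

section Legendre

lemma fwdDiff_iter_inv (n i : ℕ) :
    (fwdDiff 1)^[n] (fun i : ℕ => 1 / ((i : ℝ) + 1)) i =
      (-1) ^ n * n.factorial * i.factorial / (i + n + 1).factorial := by
  induction n generalizing i with
  | zero =>
    rw [Function.iterate_zero_apply, add_zero, Nat.factorial_succ]
    push_cast
    field_simp
    simp
  | succ n ih =>
    rw [Function.iterate_succ_apply', fwdDiff, ih, ih, show i + (n + 1) + 1 = (i + n + 1) + 1 by lia,
      show i + 1 + n + 1 = (i + n + 1) + 1 by lia, Nat.factorial_succ (i + n + 1),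
      Nat.factorial_succ i, Nat.factorial_succ n]
    push_cast
    field_simp
    ring

lemma neg_one_pow_sub {n j : ℕ} (h : j ≤ n) : (-1 : ℝ) ^ (n - j) = (-1) ^ n * (-1) ^ j := by
  obtain ⟨d, rfl⟩ := Nat.exists_eq_add_of_le h
  rw [Nat.add_sub_cancel_left, pow_add, mul_right_comm, ← mul_pow]
  simp

lemma sum_neg_one_pow_choose_mul {M : Type*} [AddCommMonoid M] (f : M → ℝ) (h : M) (n : ℕ) (y : M) :
    ∑ j ∈ Finset.range (n + 1), (-1) ^ j * n.choose j * f (y + j • h) =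
      (-1) ^ n * (fwdDiff h)^[n] f y := by
  rw [fwdDiff_iter_eq_sum_shift, Finset.mul_sum]
  refine Finset.sum_congr rfl fun j hj => ?_
  rw [zsmul_eq_mul]
  push_cast
  rw [neg_one_pow_sub (Finset.mem_range_succ_iff.mp hj), ← mul_assoc, ← mul_assoc, ← mul_assoc,
    ← mul_pow]
  simp

lemma sum_neg_one_pow_choose_div (n i : ℕ) :
    ∑ j ∈ Finset.range (n + 1), (-1) ^ j * n.choose j * (1 / ((i : ℝ) + j + 1)) =
      n.factorial * i.factorial / (i + n + 1).factorial := by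
  have h := sum_neg_one_pow_choose_mul (fun i : ℕ => 1 / ((i : ℝ) + 1)) 1 n i
  rw [fwdDiff_iter_inv] at h
  have h1 : ((-1 : ℝ) ^ n) * (-1) ^ n = 1 := by rw [← mul_pow]; simp
  calc _ = _ := Finset.sum_congr rfl fun j _ => by simp
    _ = _ := h
    _ = ((-1 : ℝ) ^ n * (-1) ^ n) * (n.factorial * i.factorial / (i + n + 1).factorial) := by ring
    _ = _ := by rw [h1, one_mul]

lemma sum_neg_one_pow_choose_eval {q : ℝ[X]} {n : ℕ} (hq : q.natDegree < n) :
    ∑ j ∈ Finset.range (n + 1), (-1) ^ j * n.choose j * q.eval (j : ℝ) = 0 := by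
  have h := sum_neg_one_pow_choose_mul (fun x => q.eval x) 1 n 0
  rw [Polynomial.fwdDiff_iter_eq_zero_of_degree_lt hq] at h
  simpa using h

/-- The moments of the shifted Legendre polynomials with respect to the monomials. -/
lemma sum_legendreCoeff_div (n i : ℕ) :
    ∑ j ∈ Finset.range (n + 1), (-1) ^ j * legendreCoeff n j * (1 / ((i : ℝ) + j + 1)) =
      (-1) ^ n * i.descFactorial n * i.factorial / (i + n + 1).factorial := by
  rcases Nat.eq_zero_or_pos n with rfl | hn
  · rw [Nat.factorial_succ]
    simp [legendreCoeff]
    field_simp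
  -- `n! (n+j choose j) = q(j)` with `q` of degree `n`. Dividing by `X - a` gives `q(j)/(i+j+1) =
  -- Q(j) + q(a)/(i+j+1)`; the `n`-th difference kills `Q`, and that of `1/(i+j+1)` is explicit. The
  -- value `q(a) = ± i(i-1)⋯(i-n+1)` vanishes for `i < n`, which is orthogonality.
  set a : ℝ := -((i : ℝ) + 1) with ha
  set q : ℝ[X] := (ascPochhammer ℝ n).comp (X + 1) with hq
  have hdeg : q.natDegree = n := by
    rw [hq, natDegree_comp, ascPochhammer_natDegree, show (X + 1 : ℝ[X]) = X + C 1 by simp,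
      natDegree_X_add_C, mul_one]
  have hqa : q.eval a = (-1) ^ n * i.descFactorial n := by
    rw [hq, eval_comp, eval_add, eval_X, eval_one, ha, neg_add_rev, neg_add_cancel_comm,
      ascPochhammer_eval_neg_eq_descPochhammer, descPochhammer_eval_eq_descFactorial]
  have hdiv := modByMonic_add_div q (X - C a)
  rw [modByMonic_X_sub_C_eq_C_eval, hqa] at hdiv
  set Q := q /ₘ (X - C a) with hQ
  have hQdeg : Q.natDegree < n := by
    rw [hQ, natDegree_divByMonic _ (monic_X_sub_C a), hdeg, natDegree_X_sub_C]
    lia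
  have hfac : (n.factorial : ℝ) ≠ 0 := by positivity
  have hterm : ∀ j : ℕ, legendreCoeff n j * (1 / ((i : ℝ) + j + 1)) =
      (1 / n.factorial : ℝ) * (n.choose j * Q.eval (j : ℝ)) +
        ((-1) ^ n * i.descFactorial n / n.factorial) * (n.choose j * (1 / ((i : ℝ) + j + 1))) := by
    intro j
    have h1 : q.eval (j : ℝ) = n.factorial * (n + j).choose j := by
      rw [hq, eval_comp, eval_add, eval_X, eval_one, ← Nat.cast_succ,
        ascPochhammer_nat_eq_natCast_ascFactorial, Nat.succ_eq_add_one,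
        Nat.ascFactorial_eq_factorial_mul_choose, add_comm n j, Nat.choose_symm_add]
      push_cast
      rfl
    have h2 : q.eval (j : ℝ) = (-1) ^ n * i.descFactorial n + ((i : ℝ) + j + 1) * Q.eval (j : ℝ) := by
      rw [← hdiv, eval_add, eval_C, eval_mul, eval_sub, eval_X, eval_C, ha]
      ring
    have h3 : ((n + j).choose j : ℝ) =
        ((-1) ^ n * i.descFactorial n + ((i : ℝ) + j + 1) * Q.eval (j : ℝ)) / n.factorial := by
      rw [← h2, h1]; field_simp
    rw [legendreCoeff, h3]
    field_simp
    ring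
  calc _ = (1 / n.factorial : ℝ) *
        (∑ j ∈ Finset.range (n + 1), (-1) ^ j * n.choose j * Q.eval (j : ℝ)) +
      ((-1) ^ n * i.descFactorial n / n.factorial) *
        ∑ j ∈ Finset.range (n + 1), (-1) ^ j * n.choose j * (1 / ((i : ℝ) + j + 1)) := by
        rw [Finset.mul_sum, Finset.mul_sum, ← Finset.sum_add_distrib]
        refine Finset.sum_congr rfl fun j _ => ?_
        rw [mul_assoc, hterm]
        ring
    _ = _ := by
        rw [sum_neg_one_pow_choose_eval hQdeg, sum_neg_one_pow_choose_div]
        field_simp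
        ring

end Legendre

/-! ### Eigenvalue bounds for the Hilbert matrix. -/

section Hilbert

open Matrix

/-- The matrix of coefficients of the normalised shifted Legendre polynomials. -/
def legendreMatrix (U : ℕ) : Matrix (Fin U) (Fin U) ℝ :=
  Matrix.of fun k j => √(2 * ((k : ℕ) : ℝ) + 1) * ((-1) ^ (j : ℕ) * legendreCoeff k j)

lemma hilbert_apply {U : ℕ} (i j : Fin U) : hilbert U i j = 1 / (((i : ℕ) : ℝ) + (j : ℕ) + 1) := rfl

lemma hilbert_transpose (U : ℕ) : (hilbert U)ᵀ = hilbert U := by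
  ext i j
  simp only [transpose_apply, hilbert_apply, add_comm]

lemma sum_hilbert_mul_legendreCoeff {U : ℕ} (i m : Fin U) :
    ∑ j : Fin U, hilbert U i j * ((-1) ^ (j : ℕ) * legendreCoeff m j) =
      (-1) ^ (m : ℕ) * (i : ℕ).descFactorial m * (i : ℕ).factorial / ((i : ℕ) + m + 1).factorial := by
  rw [← sum_legendreCoeff_div]
  rw [Finset.sum_subset (Finset.range_mono m.2)]
  · rw [Finset.sum_range]
    exact Finset.sum_congr rfl fun j _ => by rw [hilbert_apply]; ring
  · intro j _ hj
    rw [legendreCoeff_of_lt (by simpa using hj)]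
    ring

/-- Only `i = k` contributes: for `i < k` the moment vanishes by orthogonality, and for `i > k ≥ m`
the coefficient vanishes by degree. -/
lemma legendre_hilbert_entry {U : ℕ} {k m : Fin U} (h : (m : ℕ) ≤ k) :
    ∑ i : Fin U, ((-1) ^ (i : ℕ) * legendreCoeff m i) *
      ∑ j : Fin U, hilbert U i j * ((-1) ^ (j : ℕ) * legendreCoeff k j) =
    if m = k then 1 / (2 * ((k : ℕ) : ℝ) + 1) else 0 := by
  simp only [sum_hilbert_mul_legendreCoeff]
  have hz : ∀ i : Fin U, i ≠ k → ((-1) ^ (i : ℕ) * legendreCoeff m i) *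
      ((-1) ^ (k : ℕ) * ((i : ℕ).descFactorial k : ℝ) * (i : ℕ).factorial /
        ((i : ℕ) + k + 1).factorial) = 0 := by
    intro i hi
    rcases lt_or_gt_of_ne (Fin.val_ne_of_ne hi) with hik | hik
    · rw [Nat.descFactorial_of_lt hik]; simp
    · rw [legendreCoeff_of_lt (by lia)]; simp
  rw [Finset.sum_eq_single k (fun i _ hi => hz i hi) (by simp)]
  split_ifs with hmk
  · subst hmk
    rw [legendreCoeff_eq le_rfl, Nat.descFactorial_self, Nat.sub_self, Nat.factorial_zero,
      Nat.factorial_succ]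
    have h1 : ((-1 : ℝ) ^ (m : ℕ)) * (-1) ^ (m : ℕ) = 1 := by rw [← mul_pow]; simp
    have h2 : ((m : ℕ).factorial : ℝ) ≠ 0 := by positivity
    have h3 : (((m : ℕ) + m).factorial : ℝ) ≠ 0 := by positivity
    push_cast
    field_simp
    rw [sq, h1]
    field_simp
    ring
  · rw [legendreCoeff_of_lt (lt_of_le_of_ne h (Fin.val_ne_of_ne hmk))]; simp

lemma legendreMatrix_mul_hilbert_mul_apply {U : ℕ} (m k : Fin U) :
    (legendreMatrix U * (hilbert U * (legendreMatrix U)ᵀ)) m k =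
      √(2 * ((m : ℕ) : ℝ) + 1) * √(2 * ((k : ℕ) : ℝ) + 1) *
        ∑ i : Fin U, ((-1) ^ (i : ℕ) * legendreCoeff m i) *
          ∑ j : Fin U, hilbert U i j * ((-1) ^ (j : ℕ) * legendreCoeff k j) := by
  simp only [mul_apply, transpose_apply, legendreMatrix, of_apply, Finset.mul_sum]
  exact Finset.sum_congr rfl fun i _ => Finset.sum_congr rfl fun j _ => by ring

lemma legendreMatrix_mul_hilbert_mul (U : ℕ) :
    legendreMatrix U * (hilbert U * (legendreMatrix U)ᵀ) = 1 := by
  have key : ∀ m k : Fin U, (m : ℕ) ≤ k →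
      (legendreMatrix U * (hilbert U * (legendreMatrix U)ᵀ)) m k = (1 : Matrix _ _ ℝ) m k := by
    intro m k h
    rw [legendreMatrix_mul_hilbert_mul_apply, legendre_hilbert_entry h, one_apply]
    split_ifs with hmk
    · subst hmk
      rw [Real.mul_self_sqrt (by positivity)]
      field_simp
    · simp
  ext m k
  rcases le_total (m : ℕ) k with h | h
  · exact key m k h
  · have hs : (legendreMatrix U * (hilbert U * (legendreMatrix U)ᵀ))ᵀ =
        legendreMatrix U * (hilbert U * (legendreMatrix U)ᵀ) := by
      simp [transpose_mul, hilbert_transpose, mul_assoc]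
    rw [← hs, transpose_apply, key k m h, ← transpose_apply (1 : Matrix _ _ ℝ), transpose_one]

lemma sum_sq_legendreMatrix_le (n : ℕ) :
    ∑ j : Fin (n + 1), ∑ k : Fin (n + 1), legendreMatrix (n + 1) k j ^ 2 ≤
      2 * (aperyRate ^ (n + 1) / √((n : ℝ) + 1)) := by
  rw [Finset.sum_comm]
  refine le_trans (le_of_eq ?_) (sum_apery_mul_le n)
  rw [Finset.sum_range]
  refine Finset.sum_congr rfl fun k _ => ?_
  rw [apery_eq_sum k.2, Finset.sum_range, Finset.mul_sum]
  refine Finset.sum_congr rfl fun j _ => ?_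
  rw [legendreMatrix, of_apply, mul_pow, Real.sq_sqrt (by positivity), mul_pow, ← pow_mul,
    mul_comm (j : ℕ) 2, pow_mul]
  simp

/-- With `β = T H v` one has `v = Tᵀ β` and `|β|² = vᵀ H v`, so the squared Frobenius norm of `T`,
equal to `tr H⁻¹`, is an admissible constant. -/
lemma dotProduct_le_hilbert (n : ℕ) (v : Fin (n + 1) → ℝ) :
    v ⬝ᵥ v ≤ 2 * (aperyRate ^ (n + 1) / √((n : ℝ) + 1)) * (v ⬝ᵥ hilbert (n + 1) *ᵥ v) := by
  set T := legendreMatrix (n + 1) with hT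
  set M := hilbert (n + 1) with hM
  have h1 : M * (Tᵀ * T) = 1 := by
    rw [← mul_assoc]
    exact mul_eq_one_comm.mp (legendreMatrix_mul_hilbert_mul (n + 1))
  have h2 : Tᵀ * T * M = 1 := mul_eq_one_comm.mp h1
  set β := (T * M) *ᵥ v with hβ
  have hv : Tᵀ *ᵥ β = v := by
    rw [hβ, mulVec_mulVec, ← mul_assoc, h2, one_mulVec]
  have hββ : β ⬝ᵥ β = v ⬝ᵥ M *ᵥ v := by
    rw [hβ, dotProduct_mulVec, vecMul_mulVec, ← dotProduct_mulVec]
    have h3 : (T * M)ᵀ * (T * M) = M := by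
      rw [transpose_mul, hM, hilbert_transpose, ← hM, mul_assoc, ← mul_assoc Tᵀ, h2, mul_one]
    rw [h3]
  have hle : v ⬝ᵥ v ≤ (∑ j : Fin (n + 1), ∑ k : Fin (n + 1), T k j ^ 2) * (β ⬝ᵥ β) := by
    conv_lhs => rw [← hv]
    simp only [dotProduct, mulVec, transpose_apply, Finset.sum_mul, ← sq]
    refine Finset.sum_le_sum fun j _ => ?_
    rw [← Finset.sum_mul]
    exact Finset.sum_mul_sq_le_sq_mul_sq _ _ _
  rw [← hββ]
  refine hle.trans (mul_le_mul_of_nonneg_right (sum_sq_legendreMatrix_le n) ?_)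
  simpa using dotProduct_star_self_nonneg β

/-- A discrete form of `∫ dx / (√x (a² + x)) = (2/a) arctan (√x / a)`, with `arctan s` replaced by
the algebraic `s / (1 + s)` so that the bound telescopes. -/
lemma sum_schur_weight_le {a : ℝ} (ha : 1 ≤ a) (U : ℕ) :
    ∑ j ∈ Finset.range U, 1 / (√((j : ℝ) + 1) * (a ^ 2 + j)) ≤ 8 / a * (√U / (√U + a)) := by
  induction U with
  | zero => simp
  | succ j ih =>
    rw [Finset.sum_range_succ]
    refine (add_le_add_left ih _).trans ?_
    push_cast
    have hj : (0 : ℝ) ≤ j := j.cast_nonneg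
    have hs : 0 ≤ √(j : ℝ) := Real.sqrt_nonneg _
    have ht : 0 < √((j : ℝ) + 1) := Real.sqrt_pos.mpr (by positivity)
    have hs2 : √(j : ℝ) ^ 2 = j := Real.sq_sqrt hj
    have ht2 : √((j : ℝ) + 1) ^ 2 = j + 1 := Real.sq_sqrt (by positivity)
    have hst : √(j : ℝ) ≤ √((j : ℝ) + 1) := Real.sqrt_le_sqrt (by linarith)
    set s := √(j : ℝ)
    set t := √((j : ℝ) + 1)
    have ha0 : 0 < a := by linarith
    rw [← hs2]
    have h1 : (t + s) * ((t + a) * (s + a)) ≤ 8 * (t * (a ^ 2 + s ^ 2)) := by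
      have h2 : (t + a) * (s + a) ≤ 4 * (a ^ 2 + s ^ 2) := by nlinarith [sq_nonneg (t - a)]
      calc (t + s) * ((t + a) * (s + a)) ≤ (2 * t) * (4 * (a ^ 2 + s ^ 2)) :=
            mul_le_mul (by linarith) h2 (by positivity) (by positivity)
        _ = _ := by ring
    have h3 : 8 / a * (t / (t + a)) - 8 / a * (s / (s + a)) =
        8 / ((t + s) * ((t + a) * (s + a))) := by
      have : (t - s) * (t + s) = 1 := by linear_combination ht2 - hs2
      have h5 : 0 < t + s := by positivity
      field_simp
      linear_combination a * this
    have h4 : 1 / (t * (a ^ 2 + s ^ 2)) ≤ 8 / ((t + s) * ((t + a) * (s + a))) := by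
      rw [div_le_div_iff₀ (by positivity) (by positivity)]
      linarith
    linarith

lemma sum_hilbert_mul_sqrt_le {U : ℕ} (i : Fin U) :
    ∑ j : Fin U, hilbert U i j * (√(((i : ℕ) : ℝ) + 1) / √(((j : ℕ) : ℝ) + 1)) ≤ 8 := by
  have ha : 1 ≤ √(((i : ℕ) : ℝ) + 1) := Real.one_le_sqrt.mpr (by simp)
  have ha2 : √(((i : ℕ) : ℝ) + 1) ^ 2 = (i : ℕ) + 1 := Real.sq_sqrt (by positivity)
  set a := √(((i : ℕ) : ℝ) + 1)
  have h := sum_schur_weight_le ha U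
  rw [Finset.sum_range] at h
  have h1 : √(U : ℝ) / (√(U : ℝ) + a) ≤ 1 := by
    rw [div_le_one (by positivity)]
    linarith
  calc _ = a * ∑ j : Fin U, 1 / (√(((j : ℕ) : ℝ) + 1) * (a ^ 2 + (j : ℕ))) := by
        rw [Finset.mul_sum]
        refine Finset.sum_congr rfl fun j _ => ?_
        rw [hilbert_apply, ha2]
        have : 0 < √(((j : ℕ) : ℝ) + 1) := Real.sqrt_pos.mpr (by positivity)
        field_simp
        ring
    _ ≤ a * (8 / a * 1) := by
        refine mul_le_mul_of_nonneg_left (h.trans ?_) (by positivity)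
        exact mul_le_mul_of_nonneg_left h1 (by positivity)
    _ = 8 := by field_simp

/-- Schur test with weights `√(i+1)`: each product `v_i v_j` is split by the weighted
arithmetic–geometric mean inequality, and the weighted row sums are at most `8` whatever the size.
-/
lemma hilbert_le_dotProduct {U : ℕ} (v : Fin U → ℝ) :
    v ⬝ᵥ hilbert U *ᵥ v ≤ 8 * (v ⬝ᵥ v) := by
  let r : Fin U → ℝ := fun i => √(((i : ℕ) : ℝ) + 1)
  have hr : ∀ i, 0 < r i := fun i => Real.sqrt_pos.mpr (by positivity)
  have hH : ∀ i j, 0 ≤ hilbert U i j := fun i j => by rw [hilbert_apply]; positivity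
  have h1 : ∀ i j, v i * (hilbert U i j * v j) ≤
      1 / 2 * (v i ^ 2 * (hilbert U i j * (r i / r j))) +
        1 / 2 * (v j ^ 2 * (hilbert U j i * (r j / r i))) := by
    intro i j
    rw [← transpose_apply (hilbert U) i j, hilbert_transpose]
    have h2 : v i * v j ≤ 1 / 2 * (v i ^ 2 * (r i / r j)) + 1 / 2 * (v j ^ 2 * (r j / r i)) := by
      have hi := hr i
      have hj := hr j
      have h3 : 1 / 2 * (v i ^ 2 * (r i / r j)) + 1 / 2 * (v j ^ 2 * (r j / r i)) - v i * v j =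
          (v i * r i - v j * r j) ^ 2 / (2 * (r i * r j)) := by
        field_simp
        ring
      have h4 : 0 ≤ (v i * r i - v j * r j) ^ 2 / (2 * (r i * r j)) := by positivity
      linarith
    have := mul_le_mul_of_nonneg_left h2 (hH i j)
    linarith
  have h5 : ∑ i, ∑ j, v i ^ 2 * (hilbert U i j * (r i / r j)) ≤ 8 * (v ⬝ᵥ v) := by
    rw [dotProduct, Finset.mul_sum]
    refine Finset.sum_le_sum fun i _ => ?_
    rw [← Finset.mul_sum]
    have := mul_le_mul_of_nonneg_left (sum_hilbert_mul_sqrt_le i) (sq_nonneg (v i))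
    linarith
  calc v ⬝ᵥ hilbert U *ᵥ v = ∑ i, ∑ j, v i * (hilbert U i j * v j) := by
        simp only [dotProduct, mulVec, Finset.mul_sum]
    _ ≤ ∑ i, ∑ j, (1 / 2 * (v i ^ 2 * (hilbert U i j * (r i / r j))) +
          1 / 2 * (v j ^ 2 * (hilbert U j i * (r j / r i)))) :=
        Finset.sum_le_sum fun i _ => Finset.sum_le_sum fun j _ => h1 i j
    _ = ∑ i, ∑ j, v i ^ 2 * (hilbert U i j * (r i / r j)) := by
        simp only [Finset.sum_add_distrib]
        rw [Finset.sum_comm (f := fun i j => 1 / 2 * (v j ^ 2 * (hilbert U j i * (r j / r i)))),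
          ← Finset.sum_add_distrib]
        refine Finset.sum_congr rfl fun i _ => ?_
        rw [← Finset.sum_add_distrib]
        exact Finset.sum_congr rfl fun j _ => by ring
    _ ≤ _ := h5

lemma hilbert_isHermitian (U : ℕ) : (hilbert U).IsHermitian :=
  (conjTranspose_eq_transpose_of_trivial _).trans (hilbert_transpose U)

lemma hilbert_posDef (n : ℕ) : (hilbert (n + 1)).PosDef := by
  refine .of_dotProduct_mulVec_pos (hilbert_isHermitian _) fun v hv => ?_
  have h1 : 0 < v ⬝ᵥ v := by simpa using dotProduct_star_self_pos_iff.mpr hv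
  have h2 := dotProduct_le_hilbert n v
  have h3 : 0 < aperyRate ^ (n + 1) / √((n : ℝ) + 1) := by
    have := aperyRate_ge
    have : 0 < √((n : ℝ) + 1) := Real.sqrt_pos.mpr (by positivity)
    positivity
  rw [star_trivial]
  by_contra! h4
  nlinarith

lemma cond_hilbert_le (n : ℕ) :
    cond (hilbert (n + 1)) ≤ 16 * (aperyRate ^ (n + 1) / √((n : ℝ) + 1)) := by
  have hc : 0 < aperyRate ^ (n + 1) / √((n : ℝ) + 1) := by
    have := aperyRate_ge
    have : 0 < √((n : ℝ) + 1) := Real.sqrt_pos.mpr (by positivity)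
    positivity
  set c := aperyRate ^ (n + 1) / √((n : ℝ) + 1)
  have hM := hilbert_isHermitian (n + 1)
  have hev : ∀ i, 1 / (2 * c) ≤ hM.eigenvalues i ∧ hM.eigenvalues i ≤ 8 := by
    intro i
    set v : Fin (n + 1) → ℝ := WithLp.ofLp (hM.eigenvectorBasis i) with hv
    have hv1 : v ⬝ᵥ v = 1 := by
      have h := real_inner_self_eq_norm_sq (hM.eigenvectorBasis i)
      rw [hM.eigenvectorBasis.norm_eq_one, EuclideanSpace.inner_eq_star_dotProduct] at h
      simpa using h
    have hv2 : v ⬝ᵥ hilbert (n + 1) *ᵥ v = hM.eigenvalues i := by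
      rw [hv, hM.mulVec_eigenvectorBasis, ← hv, dotProduct_smul, hv1]
      simp
    have h1 := dotProduct_le_hilbert n v
    have h2 := hilbert_le_dotProduct v
    rw [hv1, hv2] at h1 h2
    refine ⟨?_, by linarith⟩
    rw [div_le_iff₀ (by positivity)]
    linarith
  rw [cond, hM.spectrum_real_eq_range_eigenvalues]
  have h1 : sSup (Set.range hM.eigenvalues) ≤ 8 :=
    csSup_le (Set.range_nonempty _) (by rintro _ ⟨i, rfl⟩; exact (hev i).2)
  have h2 : 1 / (2 * c) ≤ sInf (Set.range hM.eigenvalues) :=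
    le_csInf (Set.range_nonempty _) (by rintro _ ⟨i, rfl⟩; exact (hev i).1)
  calc _ ≤ 8 / (1 / (2 * c)) := div_le_div₀ (by norm_num) h1 (by positivity) h2
    _ = 16 * c := by field_simp; norm_num

end Hilbert

/-! ### The Hilbert matrix as a finite positive quadrature sum. -/

section Quadrature

open Matrix MeasureTheory

/-- By Carathéodory the hull is the continuous image of a simplex times `dim + 1` copies of `s`;
shorter combinations are padded with zero weights at `x₀`. -/
lemma isCompact_convexHull_of_finiteDimensional {E : Type*} [NormedAddCommGroup E]
    [NormedSpace ℝ E] [FiniteDimensional ℝ E] {s : Set E} (hs : IsCompact s) :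
    IsCompact (convexHull ℝ s) := by
  rcases s.eq_empty_or_nonempty with rfl | ⟨x₀, hx₀⟩
  · simp
  set d := Module.finrank ℝ E + 1 with hd
  let F : (Fin d → ℝ) × (Fin d → E) → E := fun q => ∑ i, q.1 i • q.2 i
  have hF : Continuous F := by fun_prop
  have hK : IsCompact ((stdSimplex ℝ (Fin d)) ×ˢ (Set.univ.pi fun _ : Fin d => s)) :=
    (isCompact_stdSimplex ℝ (Fin d)).prod (isCompact_univ_pi fun _ => hs)
  convert hK.image hF using 1
  apply Set.Subset.antisymm
  · intro x hx
    obtain ⟨ι, _, z, c, hz, hind, hc, hc1, rfl⟩ := eq_pos_convex_span_of_mem_convexHull hx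
    have hcard : Fintype.card ι ≤ Fintype.card (Fin d) := by
      rw [Fintype.card_fin]
      exact hind.card_le_finrank_succ.trans (by
        rw [hd]
        exact Nat.add_le_add_right (Submodule.finrank_le _) 1)
    obtain ⟨e⟩ := Function.Embedding.nonempty_of_card_le hcard
    classical
    refine ⟨(Function.extend e c 0, Function.extend e z fun _ => x₀), ⟨⟨fun i => ?_, ?_⟩, ?_⟩, ?_⟩
    · by_cases hi : ∃ a, e a = i
      · obtain ⟨a, rfl⟩ := hi
        simp [e.injective.extend_apply, (hc a).le]
      · simp [Function.extend_apply' _ _ _ hi]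
    · rw [← hc1]
      symm
      refine Fintype.sum_of_injective e e.injective _ _ ?_ ?_
      · intro i hi
        exact Function.extend_apply' _ _ _ (by simpa using hi)
      · intro a
        simp [e.injective.extend_apply]
    · intro i _
      by_cases hi : ∃ a, e a = i
      · obtain ⟨a, rfl⟩ := hi
        simpa [e.injective.extend_apply] using hz ⟨a, rfl⟩
      · simpa [Function.extend_apply' _ _ _ hi] using hx₀
    · symm
      refine Fintype.sum_of_injective e e.injective _ _ ?_ ?_
      · intro i hi
        dsimp only
        rw [Function.extend_apply' c _ i (by simpa using hi)]
        simp
      · intro a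
        simp [e.injective.extend_apply]
  · rintro _ ⟨⟨c, z⟩, ⟨⟨hc, hc1⟩, hz⟩, rfl⟩
    exact (convex_convexHull ℝ s).sum_mem (fun i _ => hc i) hc1
      fun i _ => subset_convexHull ℝ s (hz i (Set.mem_univ i))

/-- The moment curve. -/
def momentCurve (N : ℕ) (z : ℝ) : Fin N → ℝ := fun k => z ^ (k : ℕ)

lemma continuous_momentCurve (N : ℕ) : Continuous (momentCurve N) :=
  continuous_pi fun _ => continuous_pow _

/-- The vector is the mean of the moment curve under Lebesgue measure on `[0,1]`, and a mean lies in
the closed convex hull. -/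
lemma inv_succ_mem_convexHull (N : ℕ) :
    (fun k : Fin N => 1 / (((k : ℕ) : ℝ) + 1)) ∈
      convexHull ℝ (momentCurve N '' Set.Icc 0 1) := by
  have hclosed := (isCompact_convexHull_of_finiteDimensional
    ((isCompact_Icc (a := (0 : ℝ)) (b := 1)).image (continuous_momentCurve N))).isClosed
  let μ : Measure ℝ := volume.restrict (Set.Ioc 0 1)
  have : IsProbabilityMeasure μ := ⟨by simp [μ]⟩
  have hmem : ∀ᵐ z ∂μ, momentCurve N z ∈ convexHull ℝ (momentCurve N '' Set.Icc 0 1) :=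
    (ae_restrict_mem measurableSet_Ioc).mono fun z hz =>
      subset_convexHull ℝ _ ⟨z, Set.Ioc_subset_Icc_self hz, rfl⟩
  have hint : Integrable (momentCurve N) μ :=
    ((continuous_momentCurve N).continuousOn.integrableOn_compact isCompact_Icc).mono_set
      Set.Ioc_subset_Icc_self
  convert (convex_convexHull ℝ _).integral_mem hclosed hmem hint using 1
  funext k
  rw [eval_integral fun i => hint.eval i]
  simp only [momentCurve, μ]
  rw [← intervalIntegral.integral_of_le zero_le_one, integral_pow]
  simp

lemma exists_quadrature (n : ℕ) : ∃ (s : ℕ) (z : Fin s → ℝ) (α : Fin s → ℝ),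
    Function.Injective z ∧ (∀ i, z i ∈ Set.Icc (0 : ℝ) 1) ∧ (∀ i, 0 < α i) ∧
      hilbert (n + 1) = ∑ i, α i • Matrix.vecMulVec (fun u : Fin (n + 1) => z i ^ (u : ℕ))
        (fun u : Fin (n + 1) => z i ^ (u : ℕ)) := by
  obtain ⟨ι, _, y, c, hy, hind, hc, -, hsum⟩ :=
    -- The entries of the matrix involve the moments of order `i + j ≤ 2n`, hence dimension `2n +
    -- 1`.
    eq_pos_convex_span_of_mem_convexHull (inv_succ_mem_convexHull (2 * n + 1))
  choose z hz hzy using fun i => hy ⟨i, rfl⟩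
  let e := Fintype.equivFin ι
  refine ⟨Fintype.card ι, z ∘ e.symm, c ∘ e.symm, ?_, fun i => hz _, fun i => hc _, ?_⟩
  · refine Function.Injective.comp (fun a b hab => hind.injective ?_) e.symm.injective
    rw [← hzy a, ← hzy b, hab]
  · ext i j
    have h := congrFun hsum ⟨(i : ℕ) + j, by lia⟩
    rw [hilbert_apply, Matrix.sum_apply]
    simp only [Finset.sum_apply, Pi.smul_apply, smul_eq_mul, ← hzy, momentCurve] at h
    rw [← Equiv.sum_comp e]
    push_cast at h
    rw [← h]
    refine Finset.sum_congr rfl fun a _ => ?_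
    simp [vecMulVec_apply, pow_add]

lemma dotProduct_quadrature {U s : ℕ} (z α : Fin s → ℝ) (v : Fin U → ℝ) :
    v ⬝ᵥ (∑ i, α i • Matrix.vecMulVec (fun u : Fin U => z i ^ (u : ℕ))
      (fun u : Fin U => z i ^ (u : ℕ))) *ᵥ v = ∑ i, α i * (∑ u, v u * z i ^ (u : ℕ)) ^ 2 := by
  rw [Matrix.sum_mulVec, dotProduct_sum]
  refine Finset.sum_congr rfl fun i _ => ?_
  rw [smul_mulVec, vecMulVec_mulVec, dotProduct_smul, dotProduct_smul]
  simp only [dotProduct, smul_eq_mul, op_smul_eq_smul, sq]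
  simp only [mul_comm (z i ^ _)]

end Quadrature

/-! ### Triangle inequality and scaling for the local form. -/

section LocalFormSum

open Matrix

variable {N : Type*} [Fintype N] [DecidableEq N] {ι : Type*} [Fintype ι]

lemma localForm_sum (P : Matrix N N ℝ) (β : ι → ℝ) (A : ι → Matrix N N ℝ) :
    localForm P (∑ i, β i • A i) (∑ i, β i • A i) =
      ∑ i, ∑ j, β i * β j * localForm P (A i) (A j) := by
  simp only [localForm, Matrix.mul_sum, Matrix.sum_mul, Matrix.trace_sum]
  rw [Finset.sum_comm]
  refine Finset.sum_congr rfl fun i _ => Finset.sum_congr rfl fun j _ => ?_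
  simp [mul_assoc, mul_left_comm]

lemma localForm_sum_le {P : Matrix N N ℝ} (hP : P.PosDef) (β τ : ι → ℝ) {A : ι → Matrix N N ℝ}
    (hA : ∀ i, (A i).IsSymm) (hτ : ∀ i, localForm P (A i) (A i) ≤ τ i ^ 2) :
    localForm P (∑ i, β i • A i) (∑ i, β i • A i) ≤ (∑ i, |β i * τ i|) ^ 2 := by
  rw [localForm_sum, sq, Finset.sum_mul_sum]
  refine Finset.sum_le_sum fun i _ => Finset.sum_le_sum fun j _ => ?_
  have h1 : |localForm P (A i) (A j)| ≤ |τ i| * |τ j| := by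
    rw [← abs_mul]
    refine sq_le_sq.mp ((sq_localForm_le hP (hA i) (hA j)).trans ?_)
    rw [mul_pow]
    exact mul_le_mul (hτ i) (hτ j) (localForm_self_nonneg hP (hA j)) (sq_nonneg _)
  calc β i * β j * localForm P (A i) (A j) ≤ |β i * β j| * |localForm P (A i) (A j)| := by
        rw [← abs_mul]; exact le_abs_self _
    _ ≤ |β i * β j| * (|τ i| * |τ j|) := mul_le_mul_of_nonneg_left h1 (abs_nonneg _)
    _ = _ := by simp only [abs_mul]; ring

lemma localForm_smul {P : Matrix N N ℝ} (c : ℝ) (X : Matrix N N ℝ) (hP : IsUnit P.det)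
    (hc : c ≠ 0) : localForm (c • P) X X = (c⁻¹) ^ 2 * localForm P X X := by
  have h : (c • P)⁻¹ = c⁻¹ • P⁻¹ :=
    Matrix.inv_eq_right_inv (by
      rw [Matrix.smul_mul, Matrix.mul_smul, smul_smul, mul_inv_cancel₀ hc, one_smul,
        mul_nonsing_inv _ hP])
  simp only [localForm, h, Matrix.smul_mul, Matrix.mul_smul, Matrix.trace_smul, smul_eq_mul]
  ring

end LocalFormSum

/-! ### Weights on `[-1, 1]`: moment inequalities, `k₁`, admissibility. -/

section Interval

lemma mul_mul_mem_degreeLT {w a b : ℝ[X]} {L e n : ℕ} (hw : w.natDegree ≤ e)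
    (h : e + 2 * L ≤ n + 2) (ha : a ∈ degreeLT ℝ L) (hb : b ∈ degreeLT ℝ L) :
    w * a * b ∈ degreeLT ℝ (n + 1) := by
  rw [mem_degreeLT] at ha hb
  rcases eq_or_ne a 0 with rfl | ha0
  · simp
  rcases eq_or_ne b 0 with rfl | hb0
  · simp
  rw [← natDegree_lt_iff_degree_lt ha0] at ha
  rw [← natDegree_lt_iff_degree_lt hb0] at hb
  rw [mem_degreeLT]
  refine degree_le_natDegree.trans_lt (Nat.cast_lt.mpr ?_)
  have h1 := natDegree_mul_le (p := w * a) (q := b)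
  have h2 := natDegree_mul_le (p := w) (q := a)
  lia

lemma intervalWeights_mul_mem (n : ℕ) (i : Fin 2) (a : ℝ[X])
    (ha : a ∈ degreeLT ℝ (intervalDims n i)) (b : ℝ[X]) (hb : b ∈ degreeLT ℝ (intervalDims n i)) :
    intervalWeights n i * a * b ∈ degreeLT ℝ (n + 1) := by
  have h1 : (1 - X ^ 2 : ℝ[X]).natDegree ≤ 2 := by compute_degree
  have h2 : (1 - X : ℝ[X]).natDegree ≤ 1 := by compute_degree
  have h3 : (1 + X : ℝ[X]).natDegree ≤ 1 := by compute_degree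
  rcases Nat.even_or_odd' n with ⟨d, rfl | rfl⟩ <;> fin_cases i
  · refine mul_mul_mem_degreeLT (e := 0) ?_ ?_ ha hb
    · simp [intervalWeights]
    · simp [intervalDims]; lia
  · refine mul_mul_mem_degreeLT (e := 2) ?_ ?_ ha hb
    · simpa [intervalWeights] using h1
    · simp [intervalDims]; lia
  · refine mul_mul_mem_degreeLT (e := 1) ?_ ?_ ha hb
    · simpa [intervalWeights] using h2
    · simp [intervalDims]; lia
  · refine mul_mul_mem_degreeLT (e := 1) ?_ ?_ ha hb
    · simpa [intervalWeights] using h3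
    · simp [intervalDims]; lia

lemma eval_intervalWeights_nonneg (n : ℕ) (i : Fin 2) {z : ℝ} (h : z ∈ Set.Icc (-1 : ℝ) 1) :
    0 ≤ (intervalWeights n i).eval z := by
  obtain ⟨h1, h2⟩ := h
  rw [intervalWeights]
  split_ifs <;> fin_cases i <;> simp <;> first | linarith | exact abs_le.mpr ⟨h1, h2⟩

lemma eval_intervalWeights_pos (n : ℕ) (i : Fin 2) {z : ℝ} (h : z ∈ Set.Ioo (-1 : ℝ) 1) :
    0 < (intervalWeights n i).eval z := by
  obtain ⟨h1, h2⟩ := h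
  rw [intervalWeights]
  split_ifs <;> fin_cases i <;> simp <;> first | linarith | exact abs_lt.mpr ⟨h1, h2⟩

lemma powerVec_mem_dualCone (n : ℕ) {z : ℝ} (h : z ∈ Set.Icc (-1 : ℝ) 1) :
    powerVec (n + 1) z ∈ dualCone (intervalWeights n) (intervalDims n) (n + 1) := by
  rw [mem_dualCone_iff (intervalWeights_mul_mem n)]
  intro i r hr
  rw [moment_powerVec _ (intervalWeights_mul_mem n i r hr r hr), eval_mul, eval_mul, mul_assoc]
  exact mul_nonneg (eval_intervalWeights_nonneg n i h) (mul_self_nonneg _)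

lemma moment_X_pow {U : ℕ} (x : EuclideanSpace ℝ (Fin U)) (u : Fin U) :
    moment x (X ^ (u : ℕ)) = x u := by
  simp [moment_apply, coeff_X_pow, Fin.val_inj]

lemma X_pow_mem_degreeLT {k L : ℕ} (h : k < L) : (X ^ k : ℝ[X]) ∈ degreeLT ℝ L := by
  rw [mem_degreeLT, degree_X_pow]
  exact_mod_cast h

/-- Each bound comes from an explicit square. For even `n` use `X^(2i)`, `(1 - X²) X^(2i)` and `(X^i
± X^(i+1))²`. For odd `n` use `(1 ± X) X^(2i)`, and add `(1 - X)(X^i + X^(i+1))²` to `(1 + X)(X^i -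
X^(i+1))²`, which gives `2 X^(2i) - 2 X^(2i+2)`. -/
lemma moment_bounds {n : ℕ} {x : EuclideanSpace ℝ (Fin (n + 1))}
    (hx : x ∈ dualCone (intervalWeights n) (intervalDims n) (n + 1)) (i : ℕ) :
    (2 * i ≤ n → 0 ≤ moment x (X ^ (2 * i))) ∧
    (2 * i + 1 ≤ n → |moment x (X ^ (2 * i + 1))| ≤ moment x (X ^ (2 * i))) ∧
    (2 * i + 2 ≤ n → moment x (X ^ (2 * i + 2)) ≤ moment x (X ^ (2 * i))) := by
  rw [mem_dualCone_iff (intervalWeights_mul_mem n)] at hx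
  have h0 := hx 0
  have h1 := hx 1
  rcases Nat.even_or_odd' n with ⟨d, rfl | rfl⟩
  · simp only [intervalWeights, intervalDims, even_two_mul, if_true, Matrix.cons_val_zero,
      Matrix.cons_val_one, one_mul, show 2 * d / 2 + 1 = d + 1 by lia,
      show (2 * d + 1) / 2 = d by lia] at h0 h1
    have hA : ∀ j, 2 * j ≤ 2 * d → 0 ≤ moment x (X ^ (2 * j)) := fun j hj => by
      have := h0 (X ^ j) (X_pow_mem_degreeLT (by lia))
      rwa [← pow_add, ← two_mul] at this
    have hC : 2 * i + 2 ≤ 2 * d → moment x (X ^ (2 * i + 2)) ≤ moment x (X ^ (2 * i)) := by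
      intro hi
      have := h1 (X ^ i) (X_pow_mem_degreeLT (by lia))
      rw [show (1 - X ^ 2 : ℝ[X]) * X ^ i * X ^ i = X ^ (2 * i) - X ^ (2 * i + 2) by ring,
        map_sub] at this
      linarith
    refine ⟨hA i, fun hi => ?_, hC⟩
    have hi' : 2 * i + 2 ≤ 2 * d := by lia
    have m1 : (X ^ i : ℝ[X]) ∈ degreeLT ℝ (d + 1) := X_pow_mem_degreeLT (by lia)
    have m2 : (X ^ (i + 1) : ℝ[X]) ∈ degreeLT ℝ (d + 1) := X_pow_mem_degreeLT (by lia)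
    have e1 := h0 _ (Submodule.add_mem _ m1 m2)
    have e2 := h0 _ (Submodule.sub_mem _ m1 m2)
    rw [show ((X ^ i + X ^ (i + 1)) * (X ^ i + X ^ (i + 1)) : ℝ[X]) =
      X ^ (2 * i) + X ^ (2 * i + 1) + X ^ (2 * i + 1) + X ^ (2 * i + 2) by ring] at e1
    rw [show ((X ^ i - X ^ (i + 1)) * (X ^ i - X ^ (i + 1)) : ℝ[X]) =
      X ^ (2 * i) - X ^ (2 * i + 1) - X ^ (2 * i + 1) + X ^ (2 * i + 2) by ring] at e2
    simp only [map_add, map_sub] at e1 e2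
    have := hC hi'
    rw [abs_le]
    constructor <;> linarith
  · have hne : ¬ Even (2 * d + 1) := by simp
    simp only [intervalWeights, intervalDims, hne, if_false, Matrix.cons_val_zero,
      Matrix.cons_val_one, show (2 * d + 1) / 2 + 1 = d + 1 by lia,
      show (2 * d + 1 + 1) / 2 = d + 1 by lia] at h0 h1
    have hB : 2 * i ≤ 2 * d + 1 → |moment x (X ^ (2 * i + 1))| ≤ moment x (X ^ (2 * i)) := by
      intro hi
      have m1 : (X ^ i : ℝ[X]) ∈ degreeLT ℝ (d + 1) := X_pow_mem_degreeLT (by lia)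
      have e1 := h0 _ m1
      have e2 := h1 _ m1
      rw [show (1 - X : ℝ[X]) * X ^ i * X ^ i = X ^ (2 * i) - X ^ (2 * i + 1) by ring] at e1
      rw [show (1 + X : ℝ[X]) * X ^ i * X ^ i = X ^ (2 * i) + X ^ (2 * i + 1) by ring] at e2
      simp only [map_add, map_sub] at e1 e2
      rw [abs_le]
      constructor <;> linarith
    refine ⟨fun hi => (abs_nonneg _).trans (hB hi), fun hi => hB (by lia), fun hi => ?_⟩
    have m1 : (X ^ i : ℝ[X]) ∈ degreeLT ℝ (d + 1) := X_pow_mem_degreeLT (by lia)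
    have m2 : (X ^ (i + 1) : ℝ[X]) ∈ degreeLT ℝ (d + 1) := X_pow_mem_degreeLT (by lia)
    have e1 := h0 _ (Submodule.add_mem _ m1 m2)
    have e2 := h1 _ (Submodule.sub_mem _ m1 m2)
    rw [show (1 - X : ℝ[X]) * (X ^ i + X ^ (i + 1)) * (X ^ i + X ^ (i + 1)) =
      X ^ (2 * i) + X ^ (2 * i + 1) - X ^ (2 * i + 2) - X ^ (2 * i + 3) by ring] at e1
    rw [show (1 + X : ℝ[X]) * (X ^ i - X ^ (i + 1)) * (X ^ i - X ^ (i + 1)) =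
      X ^ (2 * i) - X ^ (2 * i + 1) - X ^ (2 * i + 2) + X ^ (2 * i + 3) by ring] at e2
    simp only [map_add, map_sub] at e1 e2
    linarith

/-- On the dual cone, the zeroth moment dominates all the others. -/
lemma abs_apply_le_apply_zero {n : ℕ} {x : EuclideanSpace ℝ (Fin (n + 1))}
    (hx : x ∈ dualCone (intervalWeights n) (intervalDims n) (n + 1)) (u : Fin (n + 1)) :
    |x u| ≤ x 0 := by
  have heven : ∀ i, 2 * i ≤ n → moment x (X ^ (2 * i)) ≤ x 0 := by
    intro i
    induction i with
    | zero => intro _; exact (moment_X_pow x 0).le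
    | succ i ih => intro hi; exact ((moment_bounds hx i).2.2 (by lia)).trans (ih (by lia))
  have hu := u.is_lt
  rw [← moment_X_pow x u]
  obtain ⟨i, hi | hi⟩ := Nat.even_or_odd' (u : ℕ) <;> rw [hi]
  · rw [abs_of_nonneg ((moment_bounds hx i).1 (by lia))]
    exact heven i (by lia)
  · exact ((moment_bounds hx i).2.1 (by lia)).trans (heven i (by lia))

lemma inner_coeffVec_one {n : ℕ} (x : EuclideanSpace ℝ (Fin (n + 1))) :
    inner ℝ (coeffVec (n + 1) 1) x = x 0 := by
  rw [inner_eq_moment, toPoly_coeffVec (by simpa using X_pow_mem_degreeLT (Nat.succ_pos n)),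
    ← moment_X_pow x 0]
  simp

lemma supNorm_le_apply_zero {n : ℕ} {x : EuclideanSpace ℝ (Fin (n + 1))}
    (hx : x ∈ dualCone (intervalWeights n) (intervalDims n) (n + 1)) : supNorm x ≤ x 0 :=
  (pi_norm_le_iff_of_nonneg ((abs_nonneg _).trans (abs_apply_le_apply_zero hx 0))).mpr
    fun u => abs_apply_le_apply_zero hx u

lemma powerVec_zero_apply (n : ℕ) (u : Fin (n + 1)) :
    powerVec (n + 1) 0 u = if u = 0 then 1 else 0 := by
  change (0 : ℝ) ^ (u : ℕ) = _
  rcases eq_or_ne u 0 with rfl | hu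
  · simp
  · rw [zero_pow (Fin.val_ne_of_ne hu), if_neg hu]

lemma isLeast_k1 (n : ℕ) :
    IsLeast (k1Values (intervalWeights n) (intervalDims n) (n + 1) (coeffVec (n + 1) 1))
      (k1 (intervalWeights n) (intervalDims n) (n + 1) (coeffVec (n + 1) 1)) := by
  have hK : IsCompact {v | v ∈ dualCone (intervalWeights n) (intervalDims n) (n + 1) ∧
      supNorm v = 1} := by
    have h1 : IsCompact ((WithLp.ofLp : EuclideanSpace ℝ (Fin (n + 1)) → _) ⁻¹'
        Metric.sphere 0 1) :=
      (PiLp.homeomorph 2 fun _ : Fin (n + 1) => ℝ).isCompact_preimage.mpr (isCompact_sphere 0 1)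
    convert h1.inter_left (isClosed_dualCone (intervalWeights n) (intervalDims n) (n + 1)) using 1
    ext v
    simp [supNorm]
  have hne : {v | v ∈ dualCone (intervalWeights n) (intervalDims n) (n + 1) ∧
      supNorm v = 1}.Nonempty := by
    have h0 := powerVec_mem_dualCone n (z := 0) (by simp)
    refine ⟨powerVec (n + 1) 0, h0, le_antisymm ?_ ?_⟩
    · refine (supNorm_le_apply_zero h0).trans ?_
      simp [powerVec_zero_apply]
    · have := norm_le_pi_norm (WithLp.ofLp (powerVec (n + 1) 0)) 0
      rw [powerVec_zero_apply] at this
      simpa [supNorm] using this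
  exact (hK.image (by fun_prop)).isLeast_sInf (hne.image _)

lemma one_le_k1 (n : ℕ) :
    1 ≤ k1 (intervalWeights n) (intervalDims n) (n + 1) (coeffVec (n + 1) 1) := by
  obtain ⟨v, ⟨hv, hv1⟩, hk⟩ := (isLeast_k1 n).1
  rw [← hk]
  dsimp only
  rw [inner_coeffVec_one, ← hv1]
  exact supNorm_le_apply_zero hv

lemma isAdmissible_hilbert (n : ℕ) : IsAdmissible (intervalWeights n) (hilbert (n + 1)) := by
  obtain ⟨s, z, α, hz, hz1, hα, hsum⟩ := exists_quadrature n
  refine ⟨s, z, α, hz, fun i j => eval_intervalWeights_nonneg n j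
    ⟨by linarith [(hz1 i).1], (hz1 i).2⟩, ?_, hα, hsum⟩
  intro r₁ hr₁ r₂ hr₂ h
  have hr : r₁ - r₂ ∈ degreeLT ℝ (n + 1) := Submodule.sub_mem _ hr₁ hr₂
  set v : Fin (n + 1) → ℝ := fun u => (r₁ - r₂).coeff u with hv
  -- Unisolvence follows from positive definiteness: a polynomial vanishing at all the nodes has `vᵀ
  -- H v = 0`.
  have hv0 : v = 0 := by
    by_contra hne
    have hpos := (hilbert_posDef n).dotProduct_mulVec_pos hne
    rw [star_trivial, hsum, dotProduct_quadrature] at hpos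
    refine hpos.ne' (Finset.sum_eq_zero fun i _ => ?_)
    have := moment_powerVec (z i) hr
    rw [eval_sub, h, sub_self] at this
    rw [show ∑ u, v u * z i ^ (u : ℕ) = 0 from this]
    ring
  rw [← sub_eq_zero, ← toPoly_coeffVec hr]
  refine Finset.sum_eq_zero fun u _ => ?_
  rw [show coeffVec (n + 1) (r₁ - r₂) u = 0 from congrFun hv0 u]
  simp

variable {n : ℕ} (p : ∀ i, Module.Basis (Fin (intervalDims n i)) ℝ (degreeLT ℝ (intervalDims n i)))

lemma exists_posDef_lambdaMap :
    ∃ x, (lambdaMap (intervalWeights n) (n + 1) p x).PosDef := by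
  -- Any `n + 1` distinct interior points would do: the weights are positive there, and a nonzero
  -- polynomial of degree less than `n + 1` cannot vanish at all of them.
  let ζ : Fin (n + 1) → ℝ := fun i => 1 / ((i : ℕ) + 2)
  have hζinj : Function.Injective ζ := by
    intro i j hij
    simp only [ζ, one_div, inv_inj, add_left_inj, Nat.cast_inj] at hij
    exact Fin.ext hij
  have hζ : ∀ i, ζ i ∈ Set.Ioo (-1 : ℝ) 1 := by
    intro i
    have h0 : (0 : ℝ) ≤ (i : ℕ) := Nat.cast_nonneg _
    constructor
    · have : 0 < ζ i := by positivity
      linarith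
    · rw [div_lt_one (by positivity)]
      linarith
  refine ⟨∑ i, powerVec (n + 1) (ζ i), posDef_lambdaMap p fun i r hr hr0 => ?_⟩
  have hmem := intervalWeights_mul_mem n i r hr r hr
  have hmom : moment (∑ j, powerVec (n + 1) (ζ j)) (intervalWeights n i * r * r) =
      ∑ j, (intervalWeights n i).eval (ζ j) * r.eval (ζ j) ^ 2 := by
    have h := inner_eq_moment (coeffVec (n + 1) (intervalWeights n i * r * r))
      (∑ j, powerVec (n + 1) (ζ j))
    rw [toPoly_coeffVec hmem, inner_sum] at h
    rw [← h]
    refine Finset.sum_congr rfl fun j _ => ?_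
    rw [inner_eq_moment, toPoly_coeffVec hmem, moment_powerVec _ hmem, eval_mul, eval_mul]
    ring
  rw [hmom]
  refine Finset.sum_pos' (fun j _ => mul_nonneg (eval_intervalWeights_pos n i (hζ j)).le
    (sq_nonneg _)) ?_
  by_contra! hall
  refine hr0 (eq_zero_of_natDegree_lt_card_of_eval_eq_zero r hζinj (fun j => ?_) ?_)
  · by_contra hne
    exact absurd (hall j (Finset.mem_univ _))
      (not_le.mpr (mul_pos (eval_intervalWeights_pos n i (hζ j)) (by positivity)))
  · rw [mem_degreeLT, ← natDegree_lt_iff_degree_lt hr0] at hr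
    have hL : intervalDims n i ≤ n + 1 := by
      fin_cases i <;> simp [intervalDims] <;> lia
    rw [Fintype.card_fin]
    lia

lemma card_sigma_intervalDims (n : ℕ) :
    Fintype.card (Σ i : Fin 2, Fin (intervalDims n i)) = n + 1 := by
  rw [Fintype.card_sigma, Fin.sum_univ_two, Fintype.card_fin, Fintype.card_fin]
  simp [intervalDims]
  lia

end Interval

/-! ### Rounding to an integer certificate and bounding its size. -/

section Certificate

variable {n : ℕ} (p : ∀ i, Module.Basis (Fin (intervalDims n i)) ℝ (degreeLT ℝ (intervalDims n i)))

lemma dotProduct_self_eq_norm_sq {U : ℕ} (v : EuclideanSpace ℝ (Fin U)) :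
    dotProduct (WithLp.ofLp v) (WithLp.ofLp v) = ‖v‖ ^ 2 := by
  rw [EuclideanSpace.real_norm_sq_eq]
  simp [dotProduct, sq]

lemma inner_powerVec {U : ℕ} (t : EuclideanSpace ℝ (Fin U)) (z : ℝ) :
    inner ℝ t (powerVec U z) = ∑ u, t u * z ^ (u : ℕ) := by
  rw [inner_eq_moment, moment_apply]
  exact Finset.sum_congr rfl fun u _ => by rw [coeff_toPoly]; rfl

/-- The local norm at the point with negative gradient `t` is bounded by the Euclidean norm. -/
lemma localForm_le_of_trace_eq {t x : EuclideanSpace ℝ (Fin (n + 1))}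
    (hx : (lambdaMap (intervalWeights n) (n + 1) p x).PosDef)
    (htx : ∀ k, inner ℝ t k = ((lambdaMap (intervalWeights n) (n + 1) p x)⁻¹ *
      lambdaMap (intervalWeights n) (n + 1) p k).trace) (h : EuclideanSpace ℝ (Fin (n + 1))) :
    localForm (lambdaMap (intervalWeights n) (n + 1) p x)
      (lambdaMap (intervalWeights n) (n + 1) p h) (lambdaMap (intervalWeights n) (n + 1) p h) ≤
      16 * (aperyRate ^ (n + 1) / √((n : ℝ) + 1)) * ‖t‖ ^ 2 * ‖h‖ ^ 2 := by
  set A := lambdaMap (intervalWeights n) (n + 1) p with hA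
  obtain ⟨s, z, α, -, hz1, hα, hsum⟩ := exists_quadrature n
  have hzI : ∀ i, z i ∈ Set.Icc (-1 : ℝ) 1 := fun i => ⟨by linarith [(hz1 i).1], (hz1 i).2⟩
  have hunit := (Matrix.isUnit_iff_isUnit_det _).mp (hilbert_posDef n).isUnit
  set c : Fin (n + 1) → ℝ := (hilbert (n + 1))⁻¹.mulVec (WithLp.ofLp h) with hc
  have hMc : (hilbert (n + 1)).mulVec c = WithLp.ofLp h := by
    rw [hc, Matrix.mulVec_mulVec, Matrix.mul_nonsing_inv _ hunit, Matrix.one_mulVec]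
  set g : Fin s → ℝ := fun i => ∑ u, c u * z i ^ (u : ℕ) with hg
  -- Applying `H H⁻¹` to `h` expands it in the nodes, with `g i` the value at `z i` of the
  -- polynomial with coefficient vector `H⁻¹ h`.
  have hh : h = ∑ i, (α i * g i) • powerVec (n + 1) (z i) := by
    ext u
    rw [← hMc, hsum, Matrix.sum_mulVec]
    simp only [Finset.sum_apply, WithLp.ofLp_sum, WithLp.ofLp_smul, Pi.smul_apply, smul_eq_mul]
    refine Finset.sum_congr rfl fun i _ => ?_
    rw [Matrix.smul_mulVec, Matrix.vecMulVec_mulVec]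
    simp only [Pi.smul_apply, op_smul_eq_smul, smul_eq_mul, dotProduct, powerVec, hg]
    simp only [mul_comm (z i ^ _), mul_assoc]
  set τ : Fin s → ℝ := fun i => inner ℝ t (powerVec (n + 1) (z i)) with hτ
  have hloc : ∀ i, localForm (A x) (A (powerVec (n + 1) (z i))) (A (powerVec (n + 1) (z i))) ≤
      τ i ^ 2 := by
    intro i
    rw [hτ]
    dsimp only
    rw [htx]
    exact localForm_self_le_sq_trace hx ((posSemidef_lambdaMap_iff p (intervalWeights_mul_mem n)).mpr
      (powerVec_mem_dualCone n (hzI i)))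
  have h1 : localForm (A x) (A h) (A h) ≤ (∑ i, |(α i * g i) * τ i|) ^ 2 := by
    rw [hh, map_sum]
    simp only [map_smul]
    exact localForm_sum_le hx _ _ (fun i => lambdaMap_isSymm _ _ p _) hloc
  -- Cauchy–Schwarz for the quadrature weights; the two factors equal `hᵀ H⁻¹ h` and `tᵀ H t`.
  have h2 : (∑ i, |(α i * g i) * τ i|) ^ 2 ≤ (∑ i, α i * g i ^ 2) * ∑ i, α i * τ i ^ 2 := by
    have := Finset.sum_mul_sq_le_sq_mul_sq Finset.univ (fun i => √(α i) * |g i|)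
      (fun i => √(α i) * |τ i|)
    simp only [mul_pow, Real.sq_sqrt (hα _).le, sq_abs] at this
    refine le_trans (le_of_eq ?_) this
    congr 1
    refine Finset.sum_congr rfl fun i _ => ?_
    rw [abs_mul, abs_mul, abs_of_pos (hα i)]
    nth_rewrite 1 [← Real.mul_self_sqrt (hα i).le]
    ring
  have h3 : ∑ i, α i * g i ^ 2 = dotProduct c (WithLp.ofLp h) := by
    rw [← hMc, hsum, dotProduct_quadrature]
  have h4 : ∑ i, α i * τ i ^ 2 ≤ 8 * ‖t‖ ^ 2 := by
    rw [← dotProduct_self_eq_norm_sq]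
    refine le_trans (le_of_eq ?_) (hilbert_le_dotProduct (WithLp.ofLp t))
    rw [hsum, dotProduct_quadrature]
    exact Finset.sum_congr rfl fun i _ => by rw [← inner_powerVec]
  set κ := aperyRate ^ (n + 1) / √((n : ℝ) + 1) with hκ
  have hκ0 : 0 ≤ κ := by
    have := aperyRate_ge
    positivity
  set γ := dotProduct c (WithLp.ofLp h) with hγ
  have hγ0 : 0 ≤ γ := by
    rw [← h3]
    exact Finset.sum_nonneg fun i _ => mul_nonneg (hα i).le (sq_nonneg _)
  have h5 : γ ≤ 2 * κ * ‖h‖ ^ 2 := by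
    have e1 := dotProduct_le_hilbert n c
    rw [hMc] at e1
    have e2 : γ ^ 2 ≤ dotProduct c c * ‖h‖ ^ 2 := by
      rw [← dotProduct_self_eq_norm_sq]
      have := Finset.sum_mul_sq_le_sq_mul_sq Finset.univ c (WithLp.ofLp h)
      rw [hγ]
      simpa only [dotProduct, ← sq] using this
    have e3 : γ * γ ≤ γ * (2 * κ * ‖h‖ ^ 2) := by
      have := mul_le_mul_of_nonneg_right e1 (sq_nonneg ‖h‖)
      nlinarith
    rcases hγ0.eq_or_lt with h0 | h0
    · rw [← h0]; positivity
    · exact le_of_mul_le_mul_left e3 h0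
  rw [h3] at h2
  calc _ ≤ γ * ∑ i, α i * τ i ^ 2 := h1.trans h2
    _ ≤ (2 * κ * ‖h‖ ^ 2) * (8 * ‖t‖ ^ 2) :=
        mul_le_mul h5 h4 (Finset.sum_nonneg fun i _ => mul_nonneg (hα i).le (sq_nonneg _))
          (by positivity)
    _ = _ := by ring

lemma norm_sub_round_le {U : ℕ} (x : EuclideanSpace ℝ (Fin U)) :
    ‖ofInt (fun u => round (x u)) - x‖ ^ 2 ≤ U / 4 := by
  rw [EuclideanSpace.real_norm_sq_eq]
  have h : ∀ u : Fin U, (ofInt (fun u => round (x u)) - x) u ^ 2 ≤ 1 / 4 := by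
    intro u
    have h1 := abs_sub_round (x u)
    have h2 : (ofInt (fun u => round (x u)) - x) u = -(x u - round (x u)) := by
      simp [ofInt]
    rw [h2, neg_sq, ← sq_abs]
    nlinarith [abs_nonneg (x u - round (x u))]
  refine (Finset.sum_le_sum fun u _ => h u).trans (le_of_eq ?_)
  simp
  ring

lemma supNorm_round_le {U : ℕ} (x : EuclideanSpace ℝ (Fin U)) :
    supNorm (ofInt fun u => round (x u)) ≤ supNorm x + 1 / 2 := by
  have h0 : 0 ≤ supNorm x := norm_nonneg _
  refine (pi_norm_le_iff_of_nonneg (by positivity)).mpr fun u => ?_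
  have h1 := abs_sub_round (x u)
  have h2 : ‖x u‖ ≤ supNorm x := norm_le_pi_norm (WithLp.ofLp x) u
  rw [Real.norm_eq_abs] at h2 ⊢
  change |((round (x u) : ℤ) : ℝ)| ≤ _
  have h3 := abs_sub_abs_le_abs_sub ((round (x u) : ℤ) : ℝ) (x u)
  rw [abs_sub_comm] at h3
  linarith

/-- If `t - ε` is on the boundary of the cone, then `ε` is at most `‖t‖`, and the sup norm of a
vector in the dual cone is at most `⟪t, x⟫ / ε`. -/
lemma bounds_of_mem_frontier {t : EuclideanSpace ℝ (Fin (n + 1))} {ε : ℝ}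
    (h : t - ε • coeffVec (n + 1) 1 ∈
      frontier (cone (intervalWeights n) (intervalDims n) (n + 1))) :
    ε ≤ ‖t‖ ∧ ∀ x ∈ dualCone (intervalWeights n) (intervalDims n) (n + 1),
      ε * x 0 ≤ inner ℝ t x := by
  have key : ∀ x ∈ dualCone (intervalWeights n) (intervalDims n) (n + 1),
      ε * x 0 ≤ inner ℝ t x := by
    intro x hx
    have := inner_nonneg_of_mem (frontier_subset_closure h) hx
    rw [inner_sub_left, real_inner_smul_left, inner_coeffVec_one] at this
    linarith
  refine ⟨?_, key⟩
  have h1 := key _ (powerVec_mem_dualCone n (z := 0) (by simp))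
  have h2 : ‖powerVec (n + 1) 0‖ = 1 := by
    rw [← sq_eq_sq₀ (norm_nonneg _) zero_le_one, EuclideanSpace.real_norm_sq_eq]
    simp [powerVec_zero_apply]
  have h3 := real_inner_le_norm t (powerVec (n + 1) 0)
  rw [h2] at h3
  rw [powerVec_zero_apply, if_pos rfl] at h1
  linarith

theorem exists_integer_dualCertificate {t : EuclideanSpace ℝ (Fin (n + 1))} {ε : ℝ}
    (ht : t ∈ interior (cone (intervalWeights n) (intervalDims n) (n + 1))) (hε : 0 < ε)
    (htε : t - ε • coeffVec (n + 1) 1 ∈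
      frontier (cone (intervalWeights n) (intervalDims n) (n + 1))) :
    ∃ y : Fin (n + 1) → ℤ, IsDualCertificate (intervalWeights n) (n + 1) p (ofInt y) t ∧
      supNorm (ofInt y) ≤ 4 * √((aperyRate ^ (n + 1) / √((n : ℝ) + 1)) * ((n : ℝ) + 1)) *
        ((n : ℝ) + 1) * (‖t‖ / ε) + 1 / 2 := by
  obtain ⟨hεt, hbound⟩ := bounds_of_mem_frontier htε
  have ht0 : 0 < ‖t‖ := hε.trans_le hεt
  obtain ⟨x₀, hx₀⟩ := exists_posDef_lambdaMap p
  have hw := intervalWeights_mul_mem n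
  have : Nonempty (Σ i : Fin 2, Fin (intervalDims n i)) := by
    rw [← Fintype.card_pos_iff, card_sigma_intervalDims]; lia
  obtain ⟨x, hx, htx⟩ := exists_trace_inv_mul_eq_inner p hw ht hx₀
  have hxd := (posSemidef_lambdaMap_iff p hw).mp hx.posSemidef
  have hloc := localForm_le_of_trace_eq p hx htx
  set A := lambdaMap (intervalWeights n) (n + 1) p with hA
  have hxu : IsUnit (A x).det := hx.det_pos.ne'.isUnit
  set κ := aperyRate ^ (n + 1) / √((n : ℝ) + 1) with hκ
  have hκ0 : 0 < κ := by
    have := aperyRate_ge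
    have : 0 < √((n : ℝ) + 1) := Real.sqrt_pos.mpr (by positivity)
    positivity
  have htxx : inner ℝ t x = (n : ℝ) + 1 := by
    rw [htx, Matrix.nonsing_inv_mul _ hxu, Matrix.trace_one, card_sigma_intervalDims]
    push_cast; rfl
  -- Rounding costs at most `(n+1)/4` in squared Euclidean norm, so this `M` makes the squared local
  -- norm of the error at `M x` at most `1/4`.
  set M := 4 * √(κ * ((n : ℝ) + 1)) * ‖t‖ with hM
  have hsq : 0 < √(κ * ((n : ℝ) + 1)) := Real.sqrt_pos.mpr (by positivity)
  have hM0 : 0 < M := by positivity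
  have hM2 : M ^ 2 = 16 * κ * ((n : ℝ) + 1) * ‖t‖ ^ 2 := by
    rw [hM, mul_pow, mul_pow, Real.sq_sqrt (by positivity)]
    ring
  have hAM : A (M • x) = M • A x := map_smul _ _ _
  refine ⟨fun u => round ((M • x) u), ?_, ?_⟩
  · refine isDualCertificate_of_localForm_lt (x := M • x) p hw hM0 ht ?_ (fun k => ?_) ?_
    · rw [← hA, hAM]
      exact hx.smul hM0
    · have hinv : (M • A x)⁻¹ = M⁻¹ • (A x)⁻¹ :=
        Matrix.inv_eq_right_inv (by
          rw [Matrix.smul_mul, Matrix.mul_smul, smul_smul, mul_inv_cancel₀ hM0.ne', one_smul,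
            Matrix.mul_nonsing_inv _ hxu])
      rw [← hA, hAM, hinv, Matrix.smul_mul, Matrix.trace_smul, smul_eq_mul,
        mul_inv_cancel_left₀ hM0.ne', htx]
    · rw [← hA, hAM, localForm_smul _ _ hxu hM0.ne']
      have h1 := hloc (ofInt (fun u => round ((M • x) u)) - M • x)
      have h2 := norm_sub_round_le (M • x)
      push_cast at h2
      calc _ ≤ (M⁻¹) ^ 2 * (16 * κ * ‖t‖ ^ 2 * (((n : ℝ) + 1) / 4)) := by
            refine mul_le_mul_of_nonneg_left (h1.trans ?_) (sq_nonneg _)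
            exact mul_le_mul_of_nonneg_left h2 (by positivity)
        _ = (M ^ 2)⁻¹ * (M ^ 2 / 4) := by rw [inv_pow, hM2]; ring
        _ = 1 / 4 := by field_simp
        _ < 1 := by norm_num
  · refine (supNorm_round_le _).trans (add_le_add_left ?_ _)
    have h1 : supNorm (M • x) = M * supNorm x := by
      rw [supNorm, WithLp.ofLp_smul, norm_smul, Real.norm_of_nonneg hM0.le, supNorm]
    have h2 : supNorm x ≤ ((n : ℝ) + 1) / ε := by
      rw [le_div_iff₀ hε, ← htxx, mul_comm]
      exact (mul_le_mul_of_nonneg_left (supNorm_le_apply_zero hxd) hε.le).trans (hbound x hxd)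
    rw [h1]
    refine (mul_le_mul_of_nonneg_left h2 hM0.le).trans (le_of_eq ?_)
    rw [hM]
    ring

/-- With `U = n + 1` and `aperyRate = (1+√2)⁴`, the square root times `U` is `U^(5/4) (1+√2)^(2U)`,
and `U ≤ 2d + 2`. -/
lemma certificate_scale_le {d n : ℕ} (h : n = 2 * d ∨ n = 2 * d + 1) :
    4 * √((aperyRate ^ (n + 1) / √((n : ℝ) + 1)) * ((n : ℝ) + 1)) * ((n : ℝ) + 1) ≤
      16 * (((d : ℝ) + 1) ^ (5 / 4 : ℝ) * (1 + √2) ^ (4 * d + 4)) := by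
  have hs : 0 ≤ √2 := Real.sqrt_nonneg 2
  set U : ℝ := (n : ℝ) + 1 with hU
  have hU0 : 0 < U := by positivity
  have hUd : U ≤ 2 * ((d : ℝ) + 1) := by
    rcases h with rfl | rfl <;> (rw [hU]; push_cast; linarith)
  have h1 : √((aperyRate ^ (n + 1) / √U) * U) * U = U ^ (5 / 4 : ℝ) * (1 + √2) ^ (2 * (n + 1)) := by
    have e1 : aperyRate ^ (n + 1) = ((1 + √2) ^ (2 * (n + 1))) ^ 2 := by
      rw [aperyRate, ← one_add_sqrt_two_pow_four, ← pow_mul, ← pow_mul]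
      congr 1
      ring
    have e2 : aperyRate ^ (n + 1) / √U * U = (U ^ (1 / 4 : ℝ) * (1 + √2) ^ (2 * (n + 1))) ^ 2 := by
      have e3 : (U ^ (1 / 4 : ℝ)) ^ 2 = √U := by
        rw [← Real.rpow_natCast, ← Real.rpow_mul hU0.le, Real.sqrt_eq_rpow]
        norm_num
      rw [e1, mul_pow, e3, div_mul_eq_mul_div, mul_div_assoc, Real.div_sqrt, mul_comm]
    rw [e2, Real.sqrt_sq (by positivity), mul_right_comm]
    congr 1
    nth_rewrite 2 [← Real.rpow_one U]
    rw [← Real.rpow_add hU0]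
    norm_num
  have h2 : U ^ (5 / 4 : ℝ) ≤ 4 * ((d : ℝ) + 1) ^ (5 / 4 : ℝ) := by
    refine (Real.rpow_le_rpow hU0.le hUd (by norm_num)).trans ?_
    rw [Real.mul_rpow (by norm_num) (by positivity)]
    refine mul_le_mul_of_nonneg_right ?_ (by positivity)
    calc (2 : ℝ) ^ (5 / 4 : ℝ) ≤ 2 ^ (2 : ℝ) :=
          Real.rpow_le_rpow_of_exponent_le (by norm_num) (by norm_num)
      _ = 4 := by norm_num
  have h3 : (1 + √2) ^ (2 * (n + 1)) ≤ (1 + √2) ^ (4 * d + 4) :=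
    pow_le_pow_right₀ (by linarith) (by lia)
  rw [mul_assoc, h1]
  have := mul_le_mul h2 h3 (by positivity) (by positivity)
  linarith

lemma log_certificate_bound_le (d : ℕ) {R : ℝ} (hR : 1 ≤ R) :
    Real.log (17 * (((d : ℝ) + 1) ^ (5 / 4 : ℝ) * (1 + √2) ^ (4 * d + 4) * R)) ≤
      9 * ((d : ℝ) + 1 + Real.log R) := by
  have hs : 0 ≤ √2 := Real.sqrt_nonneg 2
  have hd : (0 : ℝ) < d + 1 := by positivity
  have hd1 : (1 : ℝ) ≤ d + 1 := by linarith [(Nat.cast_nonneg d : (0 : ℝ) ≤ d)]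
  have hR0 : 0 < R := by linarith
  have hlR : 0 ≤ Real.log R := Real.log_nonneg hR
  rw [Real.log_mul (by norm_num) (by positivity), Real.log_mul (by positivity) hR0.ne',
    Real.log_mul (by positivity) (by positivity), Real.log_rpow hd, Real.log_pow]
  have h1 : Real.log 17 ≤ 3 := by
    rw [Real.log_le_iff_le_exp (by norm_num), show (3 : ℝ) = (3 : ℕ) * 1 by norm_num,
      Real.exp_nat_mul]
    calc (17 : ℝ) ≤ 2.7 ^ 3 := by norm_num
      _ ≤ _ := pow_le_pow_left₀ (by norm_num) (by linarith [Real.exp_one_gt_d9]) 3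
  have h2 : Real.log ((d : ℝ) + 1) ≤ d := by linarith [Real.log_le_sub_one_of_pos hd]
  have h3 : Real.log (1 + √2) ≤ 1 := by
    rw [Real.log_le_iff_le_exp (by positivity)]
    have : √2 ≤ 1.5 := by
      rw [Real.sqrt_le_left (by norm_num)]
      norm_num
    linarith [Real.exp_one_gt_d9]
  have h4 : (0 : ℝ) ≤ d := Nat.cast_nonneg d
  push_cast
  nlinarith

lemma bitSize_le {a : ℤ} {B : ℝ} (hB : 1 ≤ B) (h : |(a : ℝ)| ≤ B) :
    (bitSize a : ℝ) ≤ 4 + 2 * Real.log B := by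
  have h1 : (⌈Real.logb 2 (|(a : ℝ)| + 1)⌉ : ℝ) < Real.logb 2 (|(a : ℝ)| + 1) + 1 :=
    Int.ceil_lt_add_one _
  have h2 : Real.logb 2 (|(a : ℝ)| + 1) ≤ Real.logb 2 (2 * B) :=
    Real.logb_le_logb_of_le (by norm_num) (by positivity) (by linarith)
  have h3 : Real.logb 2 (2 * B) = 1 + Real.log B / Real.log 2 := by
    rw [Real.logb_mul (by norm_num) (by positivity), Real.logb_self_eq_one (by norm_num)]
    rfl
  have h4 : Real.log B / Real.log 2 ≤ 2 * Real.log B := by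
    have hl : 0 ≤ Real.log B := Real.log_nonneg hB
    have := Real.log_two_gt_d9
    rw [div_le_iff₀ (by linarith)]
    nlinarith
  rw [bitSize]
  push_cast
  linarith

end Certificate

end WSOS

end

theorem mainTheorem7 :
    -- (1) the minimum defining `k₁` for the constant one polynomial is attained and is at least 1
    (∀ n : ℕ,
      IsLeast
        (WSOS.k1Values (WSOS.intervalWeights n) (WSOS.intervalDims n) (n + 1)
          (WSOS.coeffVec (n + 1) 1))
        (WSOS.k1 (WSOS.intervalWeights n) (WSOS.intervalDims n) (n + 1)
          (WSOS.coeffVec (n + 1) 1)) ∧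
      1 ≤ WSOS.k1 (WSOS.intervalWeights n) (WSOS.intervalDims n) (n + 1)
          (WSOS.coeffVec (n + 1) 1)) ∧
    -- (2) an admissible matrix, namely the Hilbert matrix, with the stated condition number
    (∃ K : ℝ, 0 < K ∧ ∀ n : ℕ,
      WSOS.IsAdmissible (WSOS.intervalWeights n) (WSOS.hilbert (n + 1)) ∧
      WSOS.cond (WSOS.hilbert (n + 1)) ≤
        K * ((1 + Real.sqrt 2) ^ (4 * (n + 1)) / Real.sqrt ((n : ℝ) + 1))) ∧
    -- (3) integer certificates, for degree `n = 2 * d` or `n = 2 * d + 1`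
    (∃ K : ℝ, 0 < K ∧ ∀ d n : ℕ, n = 2 * d ∨ n = 2 * d + 1 →
      ∀ (p : ∀ i, Module.Basis (Fin (WSOS.intervalDims n i)) ℝ
          (Polynomial.degreeLT ℝ (WSOS.intervalDims n i)))
        (t : EuclideanSpace ℝ (Fin (n + 1))) (ε : ℝ),
        t ∈ interior (WSOS.cone (WSOS.intervalWeights n) (WSOS.intervalDims n) (n + 1)) →
        0 < ε →
        t - ε • WSOS.coeffVec (n + 1) 1 ∈
          frontier (WSOS.cone (WSOS.intervalWeights n) (WSOS.intervalDims n) (n + 1)) →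
        ∃ y : Fin (n + 1) → ℤ,
          WSOS.IsDualCertificate (WSOS.intervalWeights n) (n + 1) p (WSOS.ofInt y) t ∧
          WSOS.supNorm (WSOS.ofInt y) ≤
            K * (((d : ℝ) + 1) ^ (5 / 4 : ℝ) * (1 + Real.sqrt 2) ^ (4 * d + 4) * (‖t‖ / ε)) ∧
          Real.log (WSOS.supNorm (WSOS.ofInt y)) ≤
            K * ((d : ℝ) + 1 + Real.log ‖t‖ + Real.log (1 / ε)) ∧
          ∀ u, (WSOS.bitSize (y u) : ℝ) ≤
            K * ((d : ℝ) + 1 + Real.log ‖t‖ + Real.log (1 / ε))) := by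
  -- The constant `22` is set by the bit size: `4 + 2 · 9 (d + 1 + log R) ≤ 22 (d + 1 + log R)`,
  -- with `R = ‖t‖ / ε ≥ 1`.
  refine ⟨fun n => ⟨WSOS.isLeast_k1 n, WSOS.one_le_k1 n⟩, ⟨16, by norm_num, fun n =>
    ⟨WSOS.isAdmissible_hilbert n, ?_⟩⟩, ⟨22, by norm_num, ?_⟩⟩
  · rw [pow_mul, WSOS.one_add_sqrt_two_pow_four]
    exact WSOS.cond_hilbert_le n
  intro d n hdn p t ε ht hε htε
  obtain ⟨y, hy, hyn⟩ := WSOS.exists_integer_dualCertificate p ht hε htε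
  have hεt : ε ≤ ‖t‖ := (WSOS.bounds_of_mem_frontier htε).1
  have hR : 1 ≤ ‖t‖ / ε := (one_le_div hε).mpr hεt
  have hlog : Real.log ‖t‖ + Real.log (1 / ε) = Real.log (‖t‖ / ε) := by
    rw [← Real.log_mul (hε.trans_le hεt).ne' (by positivity), mul_one_div]
  have hd : (0 : ℝ) ≤ d := Nat.cast_nonneg d
  rw [add_assoc, hlog]
  set R := ‖t‖ / ε
  have hlR : 0 ≤ Real.log R := Real.log_nonneg hR
  set B : ℝ := ((d : ℝ) + 1) ^ (5 / 4 : ℝ) * (1 + Real.sqrt 2) ^ (4 * d + 4) * R with hB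
  have hB1 : 1 ≤ B := by
    refine one_le_mul_of_one_le_of_one_le (one_le_mul_of_one_le_of_one_le ?_ ?_) hR
    · exact Real.one_le_rpow (by linarith) (by norm_num)
    · exact one_le_pow₀ (by linarith [Real.sqrt_nonneg 2])
  have hyB : WSOS.supNorm (WSOS.ofInt y) ≤ 17 * B := by
    have h1 := mul_le_mul_of_nonneg_right (WSOS.certificate_scale_le hdn) (by linarith : 0 ≤ R)
    rw [mul_assoc (16 : ℝ), ← hB] at h1
    linarith
  have hlB : Real.log (17 * B) ≤ 9 * ((d : ℝ) + 1 + Real.log R) :=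
    WSOS.log_certificate_bound_le d hR
  refine ⟨y, hy, ?_, ?_, fun u => ?_⟩
  · linarith
  · have hn : 0 ≤ WSOS.supNorm (WSOS.ofInt y) := norm_nonneg _
    rcases hn.eq_or_lt with h0 | h0
    -- The convention `log 0 = 0` covers a vanishing vector.
    · rw [← h0, Real.log_zero]
      positivity
    · have := Real.log_le_log h0 hyB
      linarith
  · have h1 : |(y u : ℝ)| ≤ 17 * B := (norm_le_pi_norm _ u).trans hyB
    have h2 := WSOS.bitSize_le (by linarith) h1
    linarith
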